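/- Let $n,m\ge 1$, $\epsilon>0$, $q\in[0,1]$, $\alpha\ge 1$, and let $\mathcal X=\{X\in\mathbb R^{n\times m}:\ \|X\|_*\le\epsilon,\ 0\le X_{ij}\le 1\ \text{for all } i,j\}$, where $\|\cdot\|_*$ is the nuclear norm. Let $M\in\mathcal X$, let $Y_{ij}=1$ if $M_{ij}>q$ and $Y_{ij}=0$ otherwise, and let $S$ be the number of $1$'s in $Y$. For some $0\le k\le S$, let $\Omega$ be a uniformly random $k$-element subset of $\{(i,j): Y_{ij}=1\}$ (sampling rate $\rho=k/S$), and let $A_{ij}=1$ if $(i,j)\in\Omega$ and $A_{ij}=0$ otherwise. Let $\ell(x,a)=\frac12(x-a)^2$, and let $\ell^*$ be either of the cost-sensitive losses $$\ell^{I}(x,a)=\alpha I_{(a=1)}\ell(x,1)+I_{(a=0)}\ell(x,0),\qquad \ell^{II}(x,a)=I_{(a=1)}\ell(x,\alpha)+I_{(a=0)}\ell(x,0).$$ For $X\in\mathbb R^{n\times m}$ put $\hat R_{\ell^*}(X)=\frac1{mn}\sum_{i,j}\ell^*(X_{ij},A_{ij})$, and for a fixed $X$ let $\mathbb E[R_{\ell^*}(X)]$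 be the expectation of $\hat R_{\ell^*}(X)$ over the random choice of $\Omega$. There is a universal constant $C>0$ such that for all such data, for either loss, and for every $\delta\in(0,1)$, with probability at least $1-\delta$ over $\Omega$ the following holds: $\min_{X\in\mathcal X}\hat R_{\ell^*}(X)$ is attained; every empirical minimizer $\hat X\in\arg\min_{X\in\mathcal X}\hat R_{\ell^*}(X)$ satisfies $$\mathbb E[R_{\ell^*}(\hat X)]-\min_{X\in\mathcal X}\hat R_{\ell^*}(X)\ \le\ C\,\frac{\epsilon\alpha\left(\sqrt n+\sqrt m+\sqrt[4]{S}\right)}{mn}+\frac{\alpha\sqrt{\log(2/\delta)}}{\sqrt{mn}};$$ and, more generally, for all $X\in\mathcal X$ simultaneously, $\mathbb E[R_{\ell^*}(X)]-\hat R_{\ell^*}(X)$ is at most the same right-hand side. Here $\mathbb E[R_{\ell^*}(\hat X)]$ is the function $X\mapsto\mathbb E[R_{\ell^*}(X)]$ evaluated at $\hat X$. -/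

import Mathlib

open scoped ENNReal

noncomputable section

namespace CSRR

/-- The nuclear norm: the sum of the singular values of the matrix, seen as a linear map
between Euclidean spaces. -/
def nuclearNorm {n m : ℕ} (X : Matrix (Fin n) (Fin m) ℝ) : ℝ :=
  ∑ i ∈ Finset.range m, (Matrix.toEuclideanLin X).singularValues i

/-- The matrices with nuclear norm at most `ε` and all entries in `[0,1]`. -/
def feasible (n m : ℕ) (ε : ℝ) : Set (Matrix (Fin n) (Fin m) ℝ) :=
  {X | nuclearNorm X ≤ ε ∧ ∀ i j, 0 ≤ X i j ∧ X i j ≤ 1}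

/-- The squared loss. -/
def sqLoss (x a : ℝ) : ℝ := (x - a) ^ 2 / 2

/-- The first cost-sensitive loss: the loss on an observed one is multiplied by `α`. -/
def lossI (α x a : ℝ) : ℝ :=
  α * (if a = 1 then 1 else 0) * sqLoss x 1 + (if a = 0 then 1 else 0) * sqLoss x 0

/-- The second cost-sensitive loss: the target of an observed one is moved to `α`. -/
def lossII (α x a : ℝ) : ℝ :=
  (if a = 1 then 1 else 0) * sqLoss x α + (if a = 0 then 1 else 0) * sqLoss x 0

open Classical in
/-- The binary matrix `Y` obtained from `M` by thresholding at `q`. -/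
def binarize {n m : ℕ} (M : Matrix (Fin n) (Fin m) ℝ) (q : ℝ) : Matrix (Fin n) (Fin m) ℝ :=
  fun i j => if q < M i j then 1 else 0

open Classical in
/-- The set of positions of the ones of a matrix `Y`; its cardinality is `S`. -/
def ones {n m : ℕ} (Y : Matrix (Fin n) (Fin m) ℝ) : Finset (Fin n × Fin m) :=
  Finset.univ.filter fun p => Y p.1 p.2 = 1

/-- The observation matrix `A` of a set `Ω` of observed positions. -/
def obsMatrix {n m : ℕ} (Ω : Finset (Fin n × Fin m)) : Matrix (Fin n) (Fin m) ℝ :=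
  fun i j => if (i, j) ∈ Ω then 1 else 0

/-- The law of the set of observed positions: `k` ones of `Y` are sampled uniformly without
replacement (so the sampling rate is `k / S`). -/
def obsLaw {n m : ℕ} (Y : Matrix (Fin n) (Fin m) ℝ) (k : ℕ) (hk : k ≤ (ones Y).card) :
    PMF (Finset (Fin n × Fin m)) :=
  PMF.uniformOfFinset ((ones Y).powersetCard k) (Finset.powersetCard_nonempty.2 hk)

/-- The empirical error of `X` with respect to `A`. -/
def empRisk {n m : ℕ} (loss : ℝ → ℝ → ℝ) (A X : Matrix (Fin n) (Fin m) ℝ) : ℝ :=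
  1 / ((m : ℝ) * n) * ∑ i, ∑ j, loss (X i j) (A i j)

/-- The expected error of a fixed matrix `X`: the expectation of its empirical error over the
random set of observed positions. -/
def expRisk {n m : ℕ} (loss : ℝ → ℝ → ℝ) (Y : Matrix (Fin n) (Fin m) ℝ) (k : ℕ)
    (hk : k ≤ (ones Y).card) (X : Matrix (Fin n) (Fin m) ℝ) : ℝ :=
  ∑ Ω : Finset (Fin n × Fin m), (obsLaw Y k hk Ω).toReal * empRisk loss (obsMatrix Ω) X

/-- The bound `C ε α (√n + √m + S^(1/4)) / (m n) + α √(log (2/δ)) / √(m n)`. -/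
def lossBound (C : ℝ) (n m S : ℕ) (ε α δ : ℝ) : ℝ :=
  C * (ε * α * (√(n : ℝ) + √(m : ℝ) + (S : ℝ) ^ (1 / 4 : ℝ)) / ((m : ℝ) * n))
    + α * √(Real.log (2 / δ)) / √((m : ℝ) * n)

end CSRR

end

namespace CSRR

open scoped BigOperators

/-! ### Duality between the nuclear norm and the operator norm; compactness of the feasible set. -/

section NuclearNorm

variable {E F : Type*} [NormedAddCommGroup E] [InnerProductSpace ℝ E] [FiniteDimensional ℝ E]
  [NormedAddCommGroup F] [InnerProductSpace ℝ F] [FiniteDimensional ℝ F]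

/-! Up to the factor `1 / (m n)`, the expected minus the empirical risk at `X` is the deviation from
its mean of the sum over `Ω` of the gaps `h (X p) = loss (X p) 0 - loss (X p) 1`, where `Ω` is a
uniform `k`-subset of the ones of `Y`. On `[0,1]` both losses make `h` an `α`-Lipschitz function. It
therefore suffices to bound the supremum of this deviation over the feasible set: first its mean,
then its fluctuation.

Mean. Split a random set of `2k` positions into pairs and keep one element of each pair by a coin
flip. This bounds the mean deviation at size `k` by half of that at size `2k`, plus a Rademacher
average `R`. Complementation trades sizes above half for sizes below half at the price of a sign, so
at the worst size and sign the inequality closes up to `W ≤ W / 2 + R`, that is `W ≤ 2 R`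
(`meanDeviation_le`). Contraction (`expect_ciSup_le_of_contraction`) replaces `h (X p)` by `α * X
p`. Nuclear/operator norm duality then leaves `ε α` times the expected operator norm of a random
sign matrix, which a net argument bounds by a multiple of `√n + √m` (`exists_rademacher_bound`).
Each position carries at most one sign, so no `S^(1/4)` term arises; it is added only at the end.

Fluctuation. Exchanging one sampled position moves the supremum by at most `α`, so revealing the
sample one draw at a time and applying Hoeffding's lemma gives a subgaussian tail
(`card_filter_powersetCard_le`).

The resulting bound is uniform in `X`, hence covers minimizers that depend on `Ω`; these exist by
compactness. -/

theorem inner_apply_eigenvectorBasis (T : E →ₗ[ℝ] F) {k : ℕ} (hk : Module.finrank ℝ E = k)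
    (i j : Fin k) :
    inner ℝ (T (T.isSymmetric_adjoint_comp_self.eigenvectorBasis hk i))
      (T (T.isSymmetric_adjoint_comp_self.eigenvectorBasis hk j)) =
      if i = j then T.singularValues i ^ 2 else 0 := by
  rw [← LinearMap.adjoint_inner_left, ← LinearMap.comp_apply,
    LinearMap.IsSymmetric.apply_eigenvectorBasis, T.sq_singularValues_fin hk, inner_smul_left]
  have := orthonormal_iff_ite.1 (T.isSymmetric_adjoint_comp_self.eigenvectorBasis hk).orthonormal i j
  rw [this]
  simp

/-- In an eigenbasis `b` of `T* T` the trace is the sum of `⟪Z bᵢ, T bᵢ⟫`, and `‖T bᵢ‖` is the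
`i`-th singular value; Cauchy–Schwarz does the rest. -/
theorem trace_adjoint_comp_le (T Z : E →ₗ[ℝ] F) {k : ℕ} (hk : Module.finrank ℝ E = k)
    {K : ℝ} (hZ : ∀ x, ‖Z x‖ ≤ K * ‖x‖) :
    LinearMap.trace ℝ E (LinearMap.adjoint Z ∘ₗ T) ≤
      K * ∑ i ∈ Finset.range k, T.singularValues i := by
  set b := T.isSymmetric_adjoint_comp_self.eigenvectorBasis hk with hb
  rw [LinearMap.trace_eq_sum_inner _ b, ← Fin.sum_univ_eq_sum_range, Finset.mul_sum]
  refine Finset.sum_le_sum fun i _ => ?_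
  rw [LinearMap.comp_apply, LinearMap.adjoint_inner_right]
  have h1 : ‖T (b i)‖ = T.singularValues i := by
    have := inner_apply_eigenvectorBasis T hk i i
    rw [if_pos rfl, real_inner_self_eq_norm_sq] at this
    exact (pow_left_inj₀ (norm_nonneg _) (T.singularValues_nonneg _) two_ne_zero).1 this
  have h2 := hZ (b i)
  rw [b.norm_eq_one, mul_one] at h2
  calc _ ≤ ‖Z (b i)‖ * ‖T (b i)‖ := real_inner_le_norm _ _
    _ ≤ _ := by rw [h1]; exact mul_le_mul_of_nonneg_right h2 (T.singularValues_nonneg _)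

theorem exists_trace_adjoint_comp_eq (T : E →ₗ[ℝ] F) {k : ℕ} (hk : Module.finrank ℝ E = k) :
    ∃ Z : E →ₗ[ℝ] F, (∀ x, ‖Z x‖ ≤ ‖x‖) ∧
      LinearMap.trace ℝ E (LinearMap.adjoint Z ∘ₗ T) =
        ∑ i ∈ Finset.range k, T.singularValues i := by
  set b := T.isSymmetric_adjoint_comp_self.eigenvectorBasis hk with hb
  -- The partial isometry of the polar decomposition: `0⁻¹ = 0` makes it vanish on the kernel of
  -- `T`.
  set w : Fin k → F := fun i => (T.singularValues i)⁻¹ • T (b i) with hw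
  refine ⟨b.toBasis.constr ℝ w, fun x => ?_, ?_⟩
  · have hww : ∀ i j, inner ℝ (w i) (w j) =
        if i = j then (T.singularValues i)⁻¹ * T.singularValues i else 0 := by
      intro i j
      simp only [hw, inner_smul_left, inner_smul_right]
      rw [inner_apply_eigenvectorBasis T hk i j]
      split_ifs with h
      · subst h
        by_cases h0 : T.singularValues i = 0
        · simp [h0]
        · simp only [conj_trivial]; field_simp
      · simp
    rw [← sq_le_sq₀ (norm_nonneg _) (norm_nonneg _), ← real_inner_self_eq_norm_sq,
      ← b.sum_sq_norm_inner_right x, Module.Basis.constr_apply_fintype]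
    simp only [sum_inner, inner_sum, inner_smul_left, inner_smul_right, hww]
    simp only [mul_ite, mul_zero, Finset.sum_ite_eq', Finset.mem_univ, if_true]
    refine Finset.sum_le_sum fun i _ => ?_
    have h1 : (b.toBasis.equivFun x) i = inner ℝ (b i) x := by
      simp [b.repr_apply_apply]
    rw [h1]
    have h2 : (T.singularValues i)⁻¹ * T.singularValues i ≤ 1 := inv_mul_le_one
    simp only [conj_trivial, Real.norm_eq_abs, sq_abs]
    nlinarith [mul_self_nonneg (inner ℝ (b i) x)]
  · rw [LinearMap.trace_eq_sum_inner _ b, ← Fin.sum_univ_eq_sum_range]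
    refine Finset.sum_congr rfl fun i _ => ?_
    rw [LinearMap.comp_apply, LinearMap.adjoint_inner_right, ← b.coe_toBasis,
      Module.Basis.constr_basis, b.coe_toBasis]
    simp only [hw, inner_smul_left]
    rw [inner_apply_eigenvectorBasis T hk i i, if_pos rfl]
    by_cases h0 : T.singularValues i = 0
    · simp [h0]
    · simp; field_simp

variable {n m : ℕ}

theorem trace_adjoint_toEuclideanLin (Z X : Matrix (Fin n) (Fin m) ℝ) :
    LinearMap.trace ℝ _ (LinearMap.adjoint (Matrix.toEuclideanLin Z) ∘ₗ Matrix.toEuclideanLin X) =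
      ∑ i, ∑ j, Z i j * X i j := by
  rw [LinearMap.trace_eq_sum_inner _ (EuclideanSpace.basisFun (Fin m) ℝ), Finset.sum_comm]
  refine Finset.sum_congr rfl fun j _ => ?_
  rw [LinearMap.comp_apply, LinearMap.adjoint_inner_right]
  simp [PiLp.inner_apply, Matrix.toLpLin_apply, mul_comm]

theorem sum_mul_le_mul_nuclearNorm (Z X : Matrix (Fin n) (Fin m) ℝ) {K : ℝ}
    (hZ : ∀ x, ‖Matrix.toEuclideanLin Z x‖ ≤ K * ‖x‖) :
    ∑ i, ∑ j, Z i j * X i j ≤ K * nuclearNorm X := by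
  rw [← trace_adjoint_toEuclideanLin]
  exact trace_adjoint_comp_le _ _ finrank_euclideanSpace_fin hZ

/-- Writes the nuclear norm ball as an intersection of closed half-spaces, so that it is closed
without any continuity of singular values. -/
theorem nuclearNorm_le_iff (X : Matrix (Fin n) (Fin m) ℝ) (ε : ℝ) :
    nuclearNorm X ≤ ε ↔ ∀ Z : Matrix (Fin n) (Fin m) ℝ,
      (∀ x, ‖Matrix.toEuclideanLin Z x‖ ≤ ‖x‖) → ∑ i, ∑ j, Z i j * X i j ≤ ε := by
  constructor
  · intro h Z hZ
    have := sum_mul_le_mul_nuclearNorm Z X (K := 1) (by simpa using hZ)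
    linarith
  · intro h
    obtain ⟨Z, hZ, hZX⟩ := exists_trace_adjoint_comp_eq (Matrix.toEuclideanLin X)
      (finrank_euclideanSpace_fin (𝕜 := ℝ) (n := m))
    have := h (Matrix.toEuclideanLin.symm Z) (by simpa using hZ)
    rw [← trace_adjoint_toEuclideanLin, LinearEquiv.apply_symm_apply, hZX] at this
    exact this

theorem isCompact_feasible (ε : ℝ) : IsCompact (feasible n m ε) := by
  have hK : IsCompact (Set.univ.pi fun _ : Fin n => Set.univ.pi fun _ : Fin m => Set.Icc (0 : ℝ) 1) :=
    isCompact_univ_pi fun _ => isCompact_univ_pi fun _ => isCompact_Icc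
  have hcl : IsClosed {X : Matrix (Fin n) (Fin m) ℝ | nuclearNorm X ≤ ε} := by
    simp only [nuclearNorm_le_iff, Set.ofPred_forall]
    refine isClosed_iInter fun Z => isClosed_iInter fun _ => ?_
    exact isClosed_le (by fun_prop) continuous_const
  have h : feasible n m ε = {X | nuclearNorm X ≤ ε} ∩
      (Set.univ.pi fun _ : Fin n => Set.univ.pi fun _ : Fin m => Set.Icc (0 : ℝ) 1) := by
    ext X
    exact and_congr Iff.rfl ⟨fun h i _ j _ => h i j, fun h i j => h i trivial j trivial⟩
  rw [h]
  exact hK.inter_left hcl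

end NuclearNorm

/-! ### Exponential moments of Rademacher sums and of finite maxima. -/

/-- The real sign of a Boolean. -/
noncomputable def sgn (b : Bool) : ℝ := if b then 1 else -1

theorem sgn_mul_self (b : Bool) : sgn b * sgn b = 1 := by cases b <;> simp [sgn]

theorem sgn_not (b : Bool) : sgn (!b) = -sgn b := by cases b <;> simp [sgn]

theorem expect_exp_rademacher_le {ι : Type*} [Fintype ι] [DecidableEq ι] (w : ι → ℝ) :
    𝔼 s : ι → Bool, Real.exp (∑ i, sgn (s i) * w i) ≤ Real.exp ((∑ i, w i ^ 2) / 2) := by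
  have h1 : 𝔼 s : ι → Bool, Real.exp (∑ i, sgn (s i) * w i) = ∏ i, Real.cosh (w i) := by
    rw [Fintype.expect_eq_sum_div_card]
    simp_rw [Real.exp_sum, Real.cosh_eq, Finset.prod_div_distrib]
    congr 1
    · have := Finset.prod_univ_sum (fun _ : ι => (Finset.univ : Finset Bool))
        (fun i b => Real.exp (sgn b * w i))
      rw [Fintype.piFinset_univ] at this
      rw [← this]
      simp [sgn]
    · simp
  rw [h1, Finset.sum_div, Real.exp_sum]
  exact Finset.prod_le_prod (fun i _ => (Real.cosh_pos _).le)
    fun i _ => Real.cosh_le_exp_half_sq _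

theorem exp_expect_le {Ω : Type*} [Fintype Ω] [Nonempty Ω] (g : Ω → ℝ) :
    Real.exp (𝔼 s, g s) ≤ 𝔼 s, Real.exp (g s) := by
  set μ := 𝔼 s, g s with hμ
  have h : 𝔼 s, Real.exp μ * (g s - μ + 1) ≤ 𝔼 s, Real.exp (g s) := by
    refine Finset.expect_le_expect fun s _ => ?_
    calc _ ≤ Real.exp μ * Real.exp (g s - μ) :=
          mul_le_mul_of_nonneg_left (Real.add_one_le_exp _) (Real.exp_pos _).le
      _ = _ := by rw [← Real.exp_add]; ring_nf
  rw [← Finset.mul_expect, Finset.expect_add_distrib, Finset.expect_sub_distrib,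
    Fintype.expect_const, Fintype.expect_const, ← hμ] at h
  linarith

/-- Maximal inequality: Jensen for `exp`, then a maximum of exponentials is at most their sum. -/
theorem mul_expect_le_log_of_exp_le {Ω β : Type*} [Fintype Ω] [Nonempty Ω] (N : Finset β)
    (g : Ω → ℝ) (Y : β → Ω → ℝ) (l B : ℝ) (hl : 0 ≤ l)
    (hg : ∀ s, ∃ b ∈ N, g s ≤ Y b s) (hY : ∀ b ∈ N, 𝔼 s, Real.exp (l * Y b s) ≤ B) :
    l * 𝔼 s, g s ≤ Real.log (N.card * B) := by
  have h1 : Real.exp (l * 𝔼 s, g s) ≤ N.card * B := by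
    rw [Finset.mul_expect]
    refine (exp_expect_le _).trans ?_
    calc _ ≤ 𝔼 s, ∑ b ∈ N, Real.exp (l * Y b s) := by
          refine Finset.expect_le_expect fun s _ => ?_
          obtain ⟨b, hb, h⟩ := hg s
          refine le_trans (Real.exp_le_exp.2 (mul_le_mul_of_nonneg_left h hl)) ?_
          exact Finset.single_le_sum (f := fun b => Real.exp (l * Y b s))
            (fun _ _ => (Real.exp_pos _).le) hb
      _ = ∑ b ∈ N, 𝔼 s, Real.exp (l * Y b s) := Finset.expect_sum_comm _ _ _
      _ ≤ ∑ b ∈ N, B := Finset.sum_le_sum hY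
      _ = _ := by simp
  rw [← Real.log_exp (l * _)]
  exact Real.log_le_log (Real.exp_pos _) h1

/-! ### Euclidean nets and the norm of a random sign matrix. -/

/-- Encodings of the integer vectors of squared length at most `16 n`. -/
def netIndex (n : ℕ) : Finset (Fin n → ℕ × Bool) :=
  (Fintype.piFinset fun _ => Finset.range (16 * n + 1) ×ˢ Finset.univ).filter
    fun z => ∑ i, (z i).1 ^ 2 ≤ 16 * n

/-- The points of a `1/4`-net of the Euclidean unit ball. -/
noncomputable def netPoint {n : ℕ} (z : Fin n → ℕ × Bool) : EuclideanSpace ℝ (Fin n) :=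
  WithLp.toLp 2 fun i => sgn (z i).2 * (z i).1 / (4 * √n)

theorem card_netIndex_le (n : ℕ) : ((netIndex n).card : ℝ) ≤ 2 ^ (18 * n) := by
  have hgeom : ∑ p ∈ Finset.range (16 * n + 1) ×ˢ (Finset.univ : Finset Bool),
      (1 / 2 : ℝ) ^ p.1 ≤ 4 := by
    rw [Finset.sum_product]
    simp only [Finset.sum_const, Finset.card_univ, Fintype.card_bool, nsmul_eq_mul]
    rw [← Finset.mul_sum]
    have := sum_geometric_two_le (16 * n + 1)
    push_cast
    linarith
  calc ((netIndex n).card : ℝ) = ∑ z ∈ netIndex n, (1 : ℝ) := by simp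
    -- Every weight is at least `1`, because `∑ |zᵢ| ≤ ∑ zᵢ² ≤ 16 n` for integers. The weighted sum
    -- factors over coordinates, each contributing at most `4` (two signs times a geometric series).
    _ ≤ ∑ z ∈ netIndex n, 2 ^ (16 * n) * ∏ i, (1 / 2 : ℝ) ^ (z i).1 := by
        refine Finset.sum_le_sum fun z hz => ?_
        have hz' : ∑ i, (z i).1 ≤ 16 * n :=
          (Finset.sum_le_sum fun i _ => Nat.le_self_pow two_ne_zero _).trans
            (Finset.mem_filter.1 hz).2
        rw [Finset.prod_pow_eq_pow_sum, one_div, inv_pow, ← div_eq_mul_inv,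
          one_le_div (by positivity)]
        exact pow_le_pow_right₀ one_le_two hz'
    _ ≤ ∑ z ∈ Fintype.piFinset fun _ : Fin n =>
          Finset.range (16 * n + 1) ×ˢ (Finset.univ : Finset Bool),
          2 ^ (16 * n) * ∏ i, (1 / 2 : ℝ) ^ (z i).1 :=
        Finset.sum_le_sum_of_subset_of_nonneg (Finset.filter_subset _ _)
          fun _ _ _ => by positivity
    _ = 2 ^ (16 * n) * ∏ _i : Fin n,
          ∑ p ∈ Finset.range (16 * n + 1) ×ˢ (Finset.univ : Finset Bool), (1 / 2 : ℝ) ^ p.1 := by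
        rw [← Finset.mul_sum, Finset.prod_univ_sum]
    _ ≤ 2 ^ (16 * n) * ∏ _i : Fin n, (4 : ℝ) := by
        gcongr
    _ = 2 ^ (18 * n) := by
        simp only [Finset.prod_const, Finset.card_univ, Fintype.card_fin]
        rw [show (4 : ℝ) = 2 ^ 2 by norm_num, ← pow_mul, ← pow_add]
        ring_nf

theorem zero_mem_netIndex (n : ℕ) : (fun _ => (0, true)) ∈ netIndex n := by
  simp [netIndex]

theorem sum_sq_netPoint_le {n : ℕ} (hn : 0 < n) {z : Fin n → ℕ × Bool} (hz : z ∈ netIndex n) :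
    ∑ i, netPoint z i ^ 2 ≤ 1 := by
  have hz' : (∑ i, ((z i).1 : ℝ) ^ 2) ≤ 16 * n := by exact_mod_cast (Finset.mem_filter.1 hz).2
  have hn' : (0 : ℝ) < n := by exact_mod_cast hn
  have : ∀ i, netPoint z i ^ 2 = ((z i).1 : ℝ) ^ 2 / (16 * n) := by
    intro i
    simp only [netPoint]
    rw [div_pow, mul_pow, mul_pow, Real.sq_sqrt hn'.le, sq (sgn _), sgn_mul_self]
    norm_num
  simp_rw [this]
  rw [← Finset.sum_div, div_le_one (by positivity)]
  exact hz'

theorem norm_netPoint_le {n : ℕ} (hn : 0 < n) {z : Fin n → ℕ × Bool} (hz : z ∈ netIndex n) :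
    ‖netPoint z‖ ≤ 1 := by
  rw [EuclideanSpace.norm_eq, Real.sqrt_le_one]
  simpa using sum_sq_netPoint_le hn hz

theorem exists_netPoint_near {n : ℕ} (hn : 0 < n) (x : EuclideanSpace ℝ (Fin n)) (hx : ‖x‖ ≤ 1) :
    ∃ z ∈ netIndex n, ‖x - netPoint z‖ ≤ 1 / 4 := by
  have hn' : (0 : ℝ) < n := by exact_mod_cast hn
  have hs : 0 < √(n : ℝ) := Real.sqrt_pos.2 hn'
  have hx2 : ∑ i, x i ^ 2 ≤ 1 := by
    rw [EuclideanSpace.norm_eq, Real.sqrt_le_one] at hx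
    simpa using hx
  -- Rounding toward zero keeps the point in the ball and moves each coordinate by at most `1 / (4
  -- √n)`.
  set z : Fin n → ℕ × Bool := fun i => (⌊4 * √n * |x i|⌋₊, decide (0 ≤ x i)) with hz
  have hfl : ∀ i, ((z i).1 : ℝ) ≤ 4 * √n * |x i| := fun i => Nat.floor_le (by positivity)
  have hsum : ∑ i, (z i).1 ^ 2 ≤ 16 * n := by
    have : (∑ i, ((z i).1 : ℝ) ^ 2) ≤ 16 * n := by
      calc _ ≤ ∑ i, 16 * n * x i ^ 2 := by
            refine Finset.sum_le_sum fun i _ => ?_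
            calc _ ≤ (4 * √n * |x i|) ^ 2 := pow_le_pow_left₀ (by positivity) (hfl i) 2
              _ = _ := by rw [mul_pow, mul_pow, Real.sq_sqrt hn'.le, sq_abs]; norm_num
        _ = 16 * n * ∑ i, x i ^ 2 := by rw [Finset.mul_sum]
        _ ≤ 16 * n * 1 := by gcongr
        _ = _ := by ring
    exact_mod_cast this
  refine ⟨z, ?_, ?_⟩
  · refine Finset.mem_filter.2 ⟨Fintype.mem_piFinset.2 fun i => ?_, hsum⟩
    have h1 : (z i).1 ^ 2 ≤ ∑ i, (z i).1 ^ 2 :=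
      Finset.single_le_sum (f := fun i => (z i).1 ^ 2) (fun _ _ => Nat.zero_le _)
        (Finset.mem_univ i)
    have h2 : (z i).1 ≤ (z i).1 ^ 2 := Nat.le_self_pow two_ne_zero _
    simp only [Finset.mem_product, Finset.mem_range, Finset.mem_univ, and_true]
    omega
  · rw [EuclideanSpace.norm_eq, Real.sqrt_le_left (by norm_num)]
    have : ∀ i, ‖(x - netPoint z) i‖ ^ 2 ≤ 1 / (16 * n) := by
      intro i
      have h0 : (x - netPoint z) i = sgn (z i).2 * ((4 * √n * |x i| - (z i).1) / (4 * √n)) := by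
        simp only [netPoint, PiLp.sub_apply]
        have : x i = sgn (z i).2 * |x i| := by
          by_cases h : 0 ≤ x i
          · simp [hz, h, sgn, abs_of_nonneg h]
          · simp [hz, h, sgn, abs_of_neg (not_le.1 h)]
        conv_lhs => rw [this]
        field_simp
      have h1 : 4 * √n * |x i| - (z i).1 ≤ 1 := by
        have := (Nat.lt_floor_add_one (4 * √n * |x i|)).le
        simp only [hz]; linarith
      have h2 := hfl i
      rw [h0, Real.norm_eq_abs, sq_abs, mul_pow, sq (sgn _), sgn_mul_self, one_mul, div_pow, mul_pow,
        Real.sq_sqrt hn'.le]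
      norm_num only
      gcongr
      nlinarith
    calc _ ≤ ∑ _i : Fin n, 1 / (16 * (n : ℝ)) := Finset.sum_le_sum fun i _ => this i
      _ = 1 / 16 := by simp; field_simp
      _ ≤ _ := by norm_num

/-- For a unit `v` and `u` the direction of `A v`, moving `u` and `v` to net points costs `‖A‖ / 4`
each, so `‖A‖ ≤ K + ‖A‖ / 2`. -/
theorem norm_toEuclideanLin_le_of_net {n m : ℕ} (hn : 0 < n) (hm : 0 < m)
    (Z : Matrix (Fin n) (Fin m) ℝ) (K : ℝ)
    (hK : ∀ z ∈ netIndex n, ∀ w ∈ netIndex m,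
      ∑ i, ∑ j, netPoint z i * Z i j * netPoint w j ≤ K) (x : EuclideanSpace ℝ (Fin m)) :
    ‖Matrix.toEuclideanLin Z x‖ ≤ 2 * K * ‖x‖ := by
  set A := LinearMap.toContinuousLinearMap (Matrix.toEuclideanLin Z) with hA
  have hin : ∀ u v, inner ℝ u (A v) = ∑ i, ∑ j, u i * Z i j * v j := by
    intro u v
    simp [hA, PiLp.inner_apply, Matrix.toLpLin_apply, Matrix.mulVec, dotProduct,
      Finset.sum_mul]
    exact Finset.sum_congr rfl fun i _ => Finset.sum_congr rfl fun j _ => by ring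
  have hK0 : 0 ≤ K := by
    have := hK _ (zero_mem_netIndex n) _ (zero_mem_netIndex m)
    simpa [netPoint] using this
  have key : ‖A‖ ≤ K + ‖A‖ / 2 := by
    refine A.opNorm_le_of_unit_norm (by positivity) fun v hv => ?_
    by_cases h0 : ‖A v‖ = 0
    · rw [h0]; positivity
    set u := (‖A v‖)⁻¹ • A v with hu
    have hu1 : ‖u‖ = 1 := by
      rw [hu, norm_smul, norm_inv, norm_norm, inv_mul_cancel₀ h0]
    have huA : inner ℝ u (A v) = ‖A v‖ := by
      rw [hu, real_inner_smul_left, real_inner_self_eq_norm_sq]; field_simp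
    obtain ⟨z, hz, hzu⟩ := exists_netPoint_near hn u hu1.le
    obtain ⟨w, hw, hwv⟩ := exists_netPoint_near hm v hv.le
    have hsplit : inner ℝ u (A v) = inner ℝ (netPoint z) (A (netPoint w)) +
        inner ℝ (u - netPoint z) (A (netPoint w)) + inner ℝ u (A (v - netPoint w)) := by
      rw [map_sub, inner_sub_left, inner_sub_right]; ring
    have e1 : inner ℝ (netPoint z) (A (netPoint w)) ≤ K := by rw [hin]; exact hK z hz w hw
    have e2 : inner ℝ (u - netPoint z) (A (netPoint w)) ≤ ‖A‖ / 4 := by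
      calc _ ≤ ‖u - netPoint z‖ * ‖A (netPoint w)‖ := real_inner_le_norm _ _
        _ ≤ 1 / 4 * (‖A‖ * 1) := by
          gcongr
          exact (A.le_opNorm _).trans (by gcongr; exact norm_netPoint_le hm hw)
        _ = _ := by ring
    have e3 : inner ℝ u (A (v - netPoint w)) ≤ ‖A‖ / 4 := by
      calc _ ≤ ‖u‖ * ‖A (v - netPoint w)‖ := real_inner_le_norm _ _
        _ ≤ 1 * (‖A‖ * (1 / 4)) := by
          rw [hu1]
          gcongr
          exact (A.le_opNorm _).trans (by gcongr)
        _ = _ := by ring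
    rw [huA] at hsplit
    linarith
  have h := A.le_opNorm x
  calc ‖Matrix.toEuclideanLin Z x‖ ≤ ‖A‖ * ‖x‖ := h
    _ ≤ 2 * K * ‖x‖ := by gcongr; linarith

theorem exists_rademacher_bound {n m k : ℕ} (hn : 0 < n) (hm : 0 < m)
    (a : Fin k → Fin n × Fin m) (ha : Function.Injective a) :
    ∃ Q : (Fin k → Bool) → ℝ,
      (∀ s (X : Matrix (Fin n) (Fin m) ℝ),
        ∑ l, sgn (s l) * X (a l).1 (a l).2 ≤ Q s * nuclearNorm X) ∧
      (∀ s, 0 ≤ Q s) ∧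
      𝔼 s, Q s ≤ 38 * (√n + √m) := by
  classical
  have hne : (netIndex n ×ˢ netIndex m).Nonempty :=
    ⟨_, Finset.mk_mem_product (zero_mem_netIndex n) (zero_mem_netIndex m)⟩
  set Y : (Fin n → ℕ × Bool) × (Fin m → ℕ × Bool) → (Fin k → Bool) → ℝ := fun b s =>
    ∑ l, sgn (s l) * (netPoint b.1 (a l).1 * netPoint b.2 (a l).2) with hY
  set g : (Fin k → Bool) → ℝ := fun s => (netIndex n ×ˢ netIndex m).sup' hne fun b => Y b s with hg
  have hsum : ∀ (c : Fin n → Fin m → ℝ) (s : Fin k → Bool),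
      ∑ i, ∑ j, (∑ l, if a l = (i, j) then sgn (s l) else 0) * c i j =
        ∑ l, sgn (s l) * c (a l).1 (a l).2 := by
    intro c s
    rw [← Fintype.sum_prod_type' (f := fun i j => (∑ l, if a l = (i, j) then sgn (s l) else 0) * c i j)]
    simp_rw [Finset.sum_mul]
    rw [Finset.sum_comm]
    refine Finset.sum_congr rfl fun l _ => ?_
    simp [ite_mul]
  refine ⟨fun s => 2 * g s, fun s X => ?_, fun s => ?_, ?_⟩
  · refine (hsum (fun i j => X i j) s).symm.le.trans ?_
    refine sum_mul_le_mul_nuclearNorm (fun i j => ∑ l, if a l = (i, j) then sgn (s l) else 0) X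
      (norm_toEuclideanLin_le_of_net hn hm _ _ fun z hz w hw => ?_)
    have := hsum (fun i j => netPoint z i * netPoint w j) s
    calc _ = ∑ l, sgn (s l) * (netPoint z (a l).1 * netPoint w (a l).2) := by
          rw [← this]
          refine Finset.sum_congr rfl fun i _ => Finset.sum_congr rfl fun j _ => by ring
      _ = Y (z, w) s := rfl
      _ ≤ _ := Finset.le_sup' (fun b => Y b s) (Finset.mk_mem_product hz hw)
  · have : Y (_, _) s ≤ g s := Finset.le_sup' (fun b => Y b s)
      (Finset.mk_mem_product (zero_mem_netIndex n) (zero_mem_netIndex m))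
    have h0 : Y (fun _ => (0, true), fun _ => (0, true)) s = 0 := by simp [hY, netPoint]
    linarith
  · have hn' : (1 : ℝ) ≤ n := by exact_mod_cast hn
    have hm' : (1 : ℝ) ≤ m := by exact_mod_cast hm
    -- With this `l` the net entropy, at most `18 (n + m)`, and the exponent `l ^ 2 / 2` are both
    -- multiples of `l ^ 2`. Dividing by `l` gives `19 l`, and the factor `2` from the net gives
    -- `38`.
    set l : ℝ := √(n + m) with hl
    have hl0 : 0 < l := Real.sqrt_pos.2 (by linarith)
    have hl2 : l ^ 2 = n + m := Real.sq_sqrt (by linarith)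
    have hmgf : ∀ b ∈ netIndex n ×ˢ netIndex m,
        𝔼 s, Real.exp (l * Y b s) ≤ Real.exp (l ^ 2 / 2) := by
      intro b hb
      rw [Finset.mem_product] at hb
      have := expect_exp_rademacher_le
        (fun q => l * (netPoint b.1 (a q).1 * netPoint b.2 (a q).2))
      have e : ∀ s, l * Y b s =
          ∑ q, sgn (s q) * (l * (netPoint b.1 (a q).1 * netPoint b.2 (a q).2)) := fun s => by
        rw [hY, Finset.mul_sum]
        exact Finset.sum_congr rfl fun q _ => mul_left_comm _ _ _
      simp_rw [e]
      refine this.trans (Real.exp_le_exp.2 ?_)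
      have hw : ∑ q, (netPoint b.1 (a q).1 * netPoint b.2 (a q).2) ^ 2 ≤ 1 := by
        calc _ = ∑ p ∈ Finset.univ.image a, (netPoint b.1 p.1 * netPoint b.2 p.2) ^ 2 := by
              rw [Finset.sum_image (ha.injOn)]
          _ ≤ ∑ p : Fin n × Fin m, (netPoint b.1 p.1 * netPoint b.2 p.2) ^ 2 :=
              Finset.sum_le_sum_of_subset_of_nonneg (Finset.subset_univ _)
                fun _ _ _ => sq_nonneg _
          _ = (∑ i, netPoint b.1 i ^ 2) * ∑ j, netPoint b.2 j ^ 2 := by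
              rw [Fintype.sum_prod_type, Finset.sum_mul_sum]
              simp_rw [mul_pow]
          _ ≤ 1 * 1 := mul_le_mul (sum_sq_netPoint_le hn hb.1) (sum_sq_netPoint_le hm hb.2)
              (Finset.sum_nonneg fun _ _ => sq_nonneg _) zero_le_one
          _ = 1 := one_mul 1
      simp_rw [mul_pow l]
      rw [← Finset.mul_sum]
      nlinarith
    have h1 := mul_expect_le_log_of_exp_le _ g Y l _ hl0.le
      (fun s => by
        obtain ⟨b, hb, h⟩ := Finset.exists_mem_eq_sup' hne fun b => Y b s
        exact ⟨b, hb, h.le⟩) hmgf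
    have h2 : Real.log ((netIndex n ×ˢ netIndex m).card * Real.exp (l ^ 2 / 2)) ≤ 19 * l ^ 2 := by
      have hpos : (0 : ℝ) < (netIndex n ×ˢ netIndex m).card := by exact_mod_cast hne.card_pos
      rw [Real.log_mul hpos.ne' (Real.exp_pos _).ne', Real.log_exp]
      have : Real.log ((netIndex n ×ˢ netIndex m).card) ≤ 18 * l ^ 2 := by
        calc _ ≤ Real.log (2 ^ (18 * n) * 2 ^ (18 * m)) := by
              refine Real.log_le_log hpos ?_
              rw [Finset.card_product]
              push_cast
              exact mul_le_mul (card_netIndex_le n) (card_netIndex_le m) (by positivity)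
                (by positivity)
          _ = 18 * (n + m) * Real.log 2 := by
              rw [← pow_add, Real.log_pow]; push_cast; ring
          _ ≤ 18 * (n + m) * 1 := by
              gcongr
              linarith [Real.log_two_lt_d9]
          _ = _ := by rw [hl2]; ring
      nlinarith [sq_nonneg l]
    have h3 : 𝔼 s, g s ≤ 19 * l := by
      have := h1.trans h2
      nlinarith
    rw [← Finset.mul_expect]
    have h4 : l ≤ √n + √m := by
      rw [hl, Real.sqrt_le_left (by positivity), add_sq, Real.sq_sqrt (by linarith),
        Real.sq_sqrt (by linarith)]
      nlinarith [Real.sqrt_nonneg (n : ℝ), Real.sqrt_nonneg (m : ℝ),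
        mul_nonneg (Real.sqrt_nonneg (n : ℝ)) (Real.sqrt_nonneg (m : ℝ))]
    linarith

/-! ### Contraction principle for Rademacher averages. -/

section Contraction

variable {𝒳 : Type*}

/-- A real function is bounded. -/
def IsBdd (f : 𝒳 → ℝ) : Prop := ∃ C, ∀ x, |f x| ≤ C

theorem IsBdd.bddAbove {f : 𝒳 → ℝ} (h : IsBdd f) : BddAbove (Set.range f) := by
  obtain ⟨C, hC⟩ := h
  exact ⟨C, by rintro _ ⟨x, rfl⟩; exact (abs_le.1 (hC x)).2⟩

theorem IsBdd.add {f g : 𝒳 → ℝ} (hf : IsBdd f) (hg : IsBdd g) : IsBdd fun x => f x + g x := by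
  obtain ⟨C, hC⟩ := hf
  obtain ⟨D, hD⟩ := hg
  exact ⟨C + D, fun x => (abs_add_le _ _).trans (add_le_add (hC x) (hD x))⟩

theorem IsBdd.const_mul {f : 𝒳 → ℝ} (hf : IsBdd f) (c : ℝ) : IsBdd fun x => c * f x := by
  obtain ⟨C, hC⟩ := hf
  exact ⟨|c| * C, fun x => by rw [abs_mul]; exact mul_le_mul_of_nonneg_left (hC x) (abs_nonneg _)⟩

theorem IsBdd.neg {f : 𝒳 → ℝ} (hf : IsBdd f) : IsBdd fun x => -f x := by
  simpa using hf.const_mul (-1)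

theorem IsBdd.sub {f g : 𝒳 → ℝ} (hf : IsBdd f) (hg : IsBdd g) : IsBdd fun x => f x - g x := by
  simpa only [sub_eq_add_neg] using hf.add hg.neg

theorem IsBdd.zero : IsBdd fun _ : 𝒳 => (0 : ℝ) := ⟨0, by simp⟩

theorem IsBdd.sum {ι : Type*} (s : Finset ι) {f : ι → 𝒳 → ℝ} (hf : ∀ i ∈ s, IsBdd (f i)) :
    IsBdd fun x => ∑ i ∈ s, f i x := by
  classical
  induction s using Finset.induction_on with
  | empty => simpa using IsBdd.zero
  | insert a s ha ih =>
    simp only [Finset.sum_insert ha]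
    exact (hf a (Finset.mem_insert_self a s)).add
      (ih fun i hi => hf i (Finset.mem_insert_of_mem hi))

/-- For a pair `x, y`, the difference `φ x - φ y` is at most `ψ x - ψ y` or `ψ y - ψ x`; its sign
decides which of `x`, `y` is tested in which supremum on the right. -/
theorem ciSup_add_ciSup_le_of_contraction [Nonempty 𝒳] {G φ ψ : 𝒳 → ℝ} (hG : IsBdd G)
    (hψ : IsBdd ψ) (h : ∀ x y, |φ x - φ y| ≤ |ψ x - ψ y|) :
    (⨆ x, (G x + φ x)) + (⨆ x, (G x - φ x)) ≤ (⨆ x, (G x + ψ x)) + (⨆ x, (G x - ψ x)) := by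
  have key : ∀ x y, (G x + φ x) + (G y - φ y) ≤ (⨆ x, (G x + ψ x)) + (⨆ x, (G x - ψ x)) := by
    intro x y
    have b1 := (hG.add hψ).bddAbove
    have b2 := (hG.sub hψ).bddAbove
    have h1 := le_ciSup b1 x
    have h2 := le_ciSup b1 y
    have h3 := le_ciSup b2 x
    have h4 := le_ciSup b2 y
    have h5 := (le_abs_self _).trans (h x y)
    rcases abs_cases (ψ x - ψ y) with ⟨h6, _⟩ | ⟨h6, _⟩ <;> linarith
  have h1 : ∀ y, (⨆ x, (G x + φ x)) ≤
      (⨆ x, (G x + ψ x)) + (⨆ x, (G x - ψ x)) - (G y - φ y) :=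
    fun y => ciSup_le fun x => by linarith [key x y]
  have h2 : (⨆ x, (G x - φ x)) ≤
      (⨆ x, (G x + ψ x)) + (⨆ x, (G x - ψ x)) - (⨆ x, (G x + φ x)) :=
    ciSup_le fun y => by linarith [h1 y]
  linarith

theorem expect_bool (F : Bool → ℝ) : 𝔼 b, F b = (F true + F false) / 2 := by
  rw [Fintype.expect_eq_sum_div_card]; simp

theorem expect_fin_cons {k : ℕ} (F : (Fin (k + 1) → Bool) → ℝ) :
    𝔼 s, F s = 𝔼 b : Bool, 𝔼 s : Fin k → Bool, F (Fin.cons b s) := by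
  rw [← Finset.expect_product', Finset.univ_product_univ]
  exact (Fintype.expect_equiv (Fin.consEquiv fun _ => Bool) _ _ fun _ => rfl).symm

/-- Replaces one coordinate at a time by averaging over its own sign; the offset `G` is arbitrary so
that it can absorb the other terms. -/
theorem expect_ciSup_le_of_contraction [Nonempty 𝒳] {k : ℕ} {G : 𝒳 → ℝ} {f g : Fin k → 𝒳 → ℝ}
    (hG : IsBdd G) (hf : ∀ i, IsBdd (f i)) (hg : ∀ i, IsBdd (g i))
    (h : ∀ i x y, |f i x - f i y| ≤ |g i x - g i y|) :
    𝔼 s : Fin k → Bool, ⨆ x, (G x + ∑ i, sgn (s i) * f i x) ≤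
      𝔼 s : Fin k → Bool, ⨆ x, (G x + ∑ i, sgn (s i) * g i x) := by
  induction k generalizing G with
  | zero => simp
  | succ k ih =>
    rw [expect_fin_cons, expect_fin_cons]
    simp only [Fin.sum_univ_succ, Fin.cons_zero, Fin.cons_succ, ← add_assoc]
    calc _ ≤ 𝔼 b : Bool, 𝔼 s : Fin k → Bool,
          ⨆ x, (G x + sgn b * f 0 x + ∑ i, sgn (s i) * g i.succ x) :=
          Finset.expect_le_expect fun b _ => ih (hG.add ((hf 0).const_mul _))
            (fun i => hf i.succ) (fun i => hg i.succ) fun i => h i.succ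
      _ = 𝔼 s : Fin k → Bool, 𝔼 b : Bool,
          ⨆ x, (G x + sgn b * f 0 x + ∑ i, sgn (s i) * g i.succ x) := Finset.expect_comm _ _ _
      _ ≤ 𝔼 s : Fin k → Bool, 𝔼 b : Bool,
          ⨆ x, (G x + sgn b * g 0 x + ∑ i, sgn (s i) * g i.succ x) := by
          refine Finset.expect_le_expect fun s _ => ?_
          have := ciSup_add_ciSup_le_of_contraction (G := fun x => G x + ∑ i, sgn (s i) * g i.succ x)
            (hG.add (IsBdd.sum _ fun i _ => (hg i.succ).const_mul _)) (hg 0) (h 0)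
          rw [expect_bool, expect_bool]
          simp only [sgn, if_true, Bool.false_eq_true, if_false, one_mul, neg_one_mul,
            ← sub_eq_add_neg]
          simp only [sgn, add_sub_right_comm, add_right_comm] at this ⊢
          linarith
      _ = _ := Finset.expect_comm _ _ _

end Contraction

/-! ### Symmetrization for sampling without replacement. -/

section WithoutReplacement

theorem exists_perm_map_eq {ι : Type*} [Fintype ι] [DecidableEq ι] {A B : Finset ι}
    (h : A.card = B.card) : ∃ τ : Equiv.Perm ι, A.map τ.toEmbedding = B := by
  set e : {x // x ∈ A} ≃ {x // x ∈ B} := Finset.equivOfCardEq h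
  refine ⟨e.extendSubtype, Finset.eq_of_subset_of_card_le ?_ (by simp [h])⟩
  intro x hx
  obtain ⟨y, hy, rfl⟩ := Finset.mem_map.1 hx
  exact e.extendSubtype_mem y hy

/-- Permutations act transitively on sets of a given size, so the image of a fixed set under a
uniform permutation is uniform. This puts samples of sizes `k` and `2k` on one probability space. -/
theorem expect_powersetCard_eq_expect_perm {ι : Type*} [Fintype ι] [DecidableEq ι] (A : Finset ι)
    (g : Finset ι → ℝ) :
    𝔼 Ω ∈ Finset.powersetCard A.card Finset.univ, g Ω =
      𝔼 π : Equiv.Perm ι, g (A.map π.toEmbedding) := by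
  have h1 : ∀ Ω ∈ Finset.powersetCard A.card (Finset.univ : Finset ι),
      𝔼 π : Equiv.Perm ι, g (Ω.map π.toEmbedding) = 𝔼 π : Equiv.Perm ι, g (A.map π.toEmbedding) := by
    intro Ω hΩ
    obtain ⟨τ, rfl⟩ := exists_perm_map_eq (Finset.mem_powersetCard.1 hΩ).2.symm
    refine Fintype.expect_equiv (Equiv.mulRight τ) _ _ fun π => ?_
    rw [Finset.map_map]
    rfl
  have hne : (Finset.powersetCard A.card (Finset.univ : Finset ι)).Nonempty :=
    Finset.powersetCard_nonempty.2 (Finset.card_le_univ A)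
  calc _ = 𝔼 _π : Equiv.Perm ι, 𝔼 Ω ∈ Finset.powersetCard A.card Finset.univ, g Ω :=
        (Fintype.expect_const _).symm
    _ = 𝔼 π : Equiv.Perm ι, 𝔼 Ω ∈ Finset.powersetCard A.card Finset.univ,
          g (Ω.map π.toEmbedding) := by
        refine Finset.expect_congr rfl fun π _ => ?_
        refine (Finset.expect_equiv (π.finsetCongr) (fun Ω => ?_) fun Ω _ => rfl).symm
        simp [Finset.mem_powersetCard]
    _ = 𝔼 Ω ∈ Finset.powersetCard A.card Finset.univ, 𝔼 π : Equiv.Perm ι,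
          g (Ω.map π.toEmbedding) := Finset.expect_comm _ _ _
    _ = 𝔼 Ω ∈ Finset.powersetCard A.card (Finset.univ : Finset ι), 𝔼 π : Equiv.Perm ι,
          g (A.map π.toEmbedding) := Finset.expect_congr rfl h1
    _ = _ := Finset.expect_const hne _

variable {𝒳 ι : Type*} [Fintype ι]

/-- The largest deviation over `𝒳` of the sum over `A` from its mean value. -/
noncomputable def maxDeviation (f : ι → 𝒳 → ℝ) (A : Finset ι) : ℝ :=
  ⨆ x, (∑ i ∈ A, f i x - A.card * 𝔼 i, f i x)

/-- The average of the largest deviation over all sets of `k` elements. -/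
noncomputable def meanDeviation (f : ι → 𝒳 → ℝ) (k : ℕ) : ℝ :=
  𝔼 Ω ∈ Finset.powersetCard k Finset.univ, maxDeviation f Ω

theorem IsBdd.expect {f : ι → 𝒳 → ℝ} (hf : ∀ i, IsBdd (f i)) : IsBdd fun x => 𝔼 i, f i x := by
  simp_rw [Fintype.expect_eq_sum_div_card, div_eq_inv_mul]
  exact (IsBdd.sum _ fun i _ => hf i).const_mul _

theorem isBdd_deviation {f : ι → 𝒳 → ℝ} (hf : ∀ i, IsBdd (f i)) (A : Finset ι) :
    IsBdd fun x => ∑ i ∈ A, f i x - A.card * 𝔼 i, f i x :=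
  (IsBdd.sum _ fun i _ => hf i).sub ((IsBdd.expect hf).const_mul _)

variable [DecidableEq ι]

theorem maxDeviation_compl (f : ι → 𝒳 → ℝ) (A : Finset ι) :
    maxDeviation f A = maxDeviation (fun i x => -f i x) Aᶜ := by
  unfold maxDeviation
  congr 1
  ext x
  rw [Finset.expect_neg_distrib, Finset.sum_neg_distrib, Finset.card_compl,
    Nat.cast_sub (Finset.card_le_univ A)]
  have h1 := Finset.sum_add_sum_compl A fun i => f i x
  have h2 := Fintype.card_mul_expect (fun i => f i x)
  linarith

theorem meanDeviation_compl (f : ι → 𝒳 → ℝ) {k : ℕ} (hk : k ≤ Fintype.card ι) :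
    meanDeviation f k = meanDeviation (fun i x => -f i x) (Fintype.card ι - k) := by
  unfold meanDeviation
  refine Finset.expect_nbij' (fun A => Aᶜ) (fun A => Aᶜ) ?_ ?_ (by simp) (by simp)
    fun A _ => maxDeviation_compl f A
  · intro A hA
    simp only [Finset.mem_powersetCard_univ] at hA ⊢
    rw [Finset.card_compl, hA]
  · intro A hA
    simp only [Finset.mem_powersetCard_univ] at hA ⊢
    rw [Finset.card_compl, hA]
    omega

/-- `P` consists of `k` pairs and `A s` picks one element of each. The sum over `A s` is half the
sum over `P` plus half of two Rademacher sums, with signs `s` on the first elements and `-s` on the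
second; each has mean supremum at most `R`. -/
theorem meanDeviation_le_half [Nonempty 𝒳] {f : ι → 𝒳 → ℝ} (hf : ∀ i, IsBdd (f i)) {k : ℕ}
    (hk : k + k ≤ Fintype.card ι) {R : ℝ}
    (hR : ∀ a : Fin k → ι, Function.Injective a →
      𝔼 s : Fin k → Bool, ⨆ x, ∑ l, sgn (s l) * f (a l) x ≤ R) :
    meanDeviation f k ≤ meanDeviation f (k + k) / 2 + R := by
  obtain ⟨c⟩ : Nonempty (Fin k ⊕ Fin k ↪ ι) :=
    Function.Embedding.nonempty_of_card_le (by simpa using hk)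
  set a : Fin k → ι := fun l => c (Sum.inl l) with ha
  set b : Fin k → ι := fun l => c (Sum.inr l) with hb
  have hinj : ∀ s : Fin k → Bool, Function.Injective fun l => if s l then a l else b l := by
    intro s l l' h
    simp only [ha, hb] at h
    split_ifs at h <;> simp at h <;> exact h
  set A : (Fin k → Bool) → Finset ι := fun s => Finset.univ.map ⟨_, hinj s⟩ with hA
  have hAc : ∀ s, (A s).card = k := fun s => by simp [hA]
  set P : Finset ι := Finset.univ.map c with hP
  have hPc : P.card = k + k := by simp [hP]
  have hpt : ∀ (π : Equiv.Perm ι) (s : Fin k → Bool), maxDeviation f ((A s).map π.toEmbedding) ≤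
      maxDeviation f (P.map π.toEmbedding) / 2 +
        (⨆ x, ∑ l, sgn (s l) * f (π (a l)) x) / 2 +
        (⨆ x, ∑ l, sgn (!s l) * f (π (b l)) x) / 2 := by
    intro π s
    refine ciSup_le fun x => ?_
    have h1 : _ ≤ maxDeviation f (P.map π.toEmbedding) :=
      le_ciSup (isBdd_deviation hf (P.map π.toEmbedding)).bddAbove x
    have h2 := le_ciSup (IsBdd.sum Finset.univ (f := fun l x => sgn (s l) * f (π (a l)) x)
      fun l _ => (hf (π (a l))).const_mul (sgn (s l))).bddAbove x
    have h3 := le_ciSup (IsBdd.sum Finset.univ (f := fun l x => sgn (!s l) * f (π (b l)) x)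
      fun l _ => (hf (π (b l))).const_mul (sgn (!s l))).bddAbove x
    have e1 : ∑ i ∈ (A s).map π.toEmbedding, f i x =
        (∑ i ∈ P.map π.toEmbedding, f i x) / 2 + (∑ l, sgn (s l) * f (π (a l)) x) / 2 +
          (∑ l, sgn (!s l) * f (π (b l)) x) / 2 := by
      simp only [hA, hP, Finset.sum_map, Fintype.sum_sum_type, Function.Embedding.coeFn_mk]
      simp only [← add_div, ← Finset.sum_add_distrib]
      rw [eq_div_iff two_ne_zero, Finset.sum_mul]
      refine Finset.sum_congr rfl fun l _ => ?_
      cases s l <;> simp [sgn, ha, hb] <;> ring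
    simp only [Finset.card_map, hAc, hPc] at h1 ⊢
    rw [e1]
    push_cast at h1 ⊢
    linarith
  have hW : ∀ s, meanDeviation f k = 𝔼 π : Equiv.Perm ι,
      maxDeviation f ((A s).map π.toEmbedding) := fun s => by
    rw [← expect_powersetCard_eq_expect_perm, hAc, meanDeviation]
  have hW2 : meanDeviation f (k + k) = 𝔼 π : Equiv.Perm ι,
      maxDeviation f (P.map π.toEmbedding) := by
    rw [← expect_powersetCard_eq_expect_perm, hPc, meanDeviation]
  have hRb : ∀ π : Equiv.Perm ι,
      𝔼 s : Fin k → Bool, ⨆ x, ∑ l, sgn (!s l) * f (π (b l)) x ≤ R := by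
    intro π
    refine le_trans (le_of_eq ?_)
      (hR (fun l => π (b l)) (π.injective.comp (c.injective.comp Sum.inr_injective)))
    exact Fintype.expect_equiv (Equiv.arrowCongr (Equiv.refl _) Equiv.boolNot) _ _ fun s => rfl
  calc meanDeviation f k = 𝔼 _s : Fin k → Bool, meanDeviation f k := (Fintype.expect_const _).symm
    _ = 𝔼 s : Fin k → Bool, 𝔼 π : Equiv.Perm ι, maxDeviation f ((A s).map π.toEmbedding) :=
        Finset.expect_congr rfl fun s _ => hW s
    _ = 𝔼 π : Equiv.Perm ι, 𝔼 s : Fin k → Bool, maxDeviation f ((A s).map π.toEmbedding) :=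
        Finset.expect_comm _ _ _
    _ ≤ 𝔼 π : Equiv.Perm ι, (maxDeviation f (P.map π.toEmbedding) / 2 + R) := by
        refine Finset.expect_le_expect fun π _ => ?_
        refine (Finset.expect_le_expect fun s _ => hpt π s).trans ?_
        rw [Finset.expect_add_distrib, Finset.expect_add_distrib, Fintype.expect_const,
          ← Finset.expect_div, ← Finset.expect_div]
        have h1 := hR (fun l => π (a l)) (π.injective.comp (c.injective.comp Sum.inl_injective))
        have h2 := hRb π
        linarith
    _ = _ := by
        rw [Finset.expect_add_distrib, Fintype.expect_const, ← Finset.expect_div, hW2]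

theorem meanDeviation_le [Nonempty 𝒳] {f : ι → 𝒳 → ℝ} (hf : ∀ i, IsBdd (f i)) {R : ℝ}
    (hR : ∀ (k : ℕ) (a : Fin k → ι), Function.Injective a →
      𝔼 s : Fin k → Bool, ⨆ x, ∑ l, sgn (s l) * f (a l) x ≤ R) {k : ℕ}
    (hk : k ≤ Fintype.card ι) : meanDeviation f k ≤ 2 * R := by
  set W : Bool × ℕ → ℝ := fun p => meanDeviation (fun i x => sgn p.1 * f i x) p.2 with hW
  have hbd : ∀ b, ∀ i, IsBdd fun x => sgn b * f i x := fun b i => (hf i).const_mul _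
  have hRs : ∀ (b : Bool) (k : ℕ) (a : Fin k → ι), Function.Injective a →
      𝔼 s : Fin k → Bool, ⨆ x, ∑ l, sgn (s l) * (sgn b * f (a l) x) ≤ R := by
    intro b k a ha
    cases b
    · refine le_trans (le_of_eq ?_) (hR k a ha)
      refine Fintype.expect_equiv (Equiv.arrowCongr (Equiv.refl _) Equiv.boolNot) _ _ fun s => ?_
      refine iSup_congr fun x => Finset.sum_congr rfl fun l _ => ?_
      change _ = sgn (!s l) * _
      rw [sgn_not]
      simp [sgn]
    · simpa [sgn] using hR k a ha
  have hcompl : ∀ b k, k ≤ Fintype.card ι → W (b, k) = W (!b, Fintype.card ι - k) := by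
    intro b k hk
    simp only [hW]
    rw [meanDeviation_compl _ hk]
    simp [sgn_not]
  -- At a maximizer of `W`, doubling the size (after complementing if `2 j` exceeds the population)
  -- cannot increase `W`, so `W ≤ W / 2 + R`.
  obtain ⟨⟨b, j⟩, hp, hmax⟩ := Finset.exists_max_image
    ((Finset.univ : Finset Bool) ×ˢ Finset.range (Fintype.card ι + 1)) W ⟨(true, 0), by simp⟩
  have hj : j ≤ Fintype.card ι := by simpa [Nat.lt_succ_iff] using hp
  have half : ∀ b k, k + k ≤ Fintype.card ι → W (b, k) ≤ W (b, k + k) / 2 + R := fun b k hk =>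
    meanDeviation_le_half (hbd b) hk (hRs b k)
  have hbj : W (b, j) ≤ 2 * R := by
    rcases le_total (j + j) (Fintype.card ι) with h | h
    · have h1 := half b j h
      have h2 := hmax (b, j + j) (by simp; omega)
      linarith
    · have h0 := hcompl b j hj
      have h1 := half (!b) (Fintype.card ι - j) (by omega)
      have h2 := hmax (!b, (Fintype.card ι - j) + (Fintype.card ι - j)) (by simp; omega)
      linarith
  have h1 := hmax (true, k) (by simp; omega)
  have h2 : W (true, k) = meanDeviation f k := by simp [hW, sgn]
  linarith

end WithoutReplacement

/-! ### Concentration under sampling without replacement. -/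

section BoundedDifferences

variable {β : Type*}

theorem expect_exp_sub_expect_le (T : Finset β) (hT : T.Nonempty) (D : β → ℝ) {c : ℝ}
    (hD : ∀ x ∈ T, ∀ y ∈ T, |D x - D y| ≤ c) :
    𝔼 x ∈ T, Real.exp (D x - 𝔼 y ∈ T, D y) ≤ Real.exp (c ^ 2 / 8) := by
  classical
  let _ : MeasurableSpace β := ⊤
  set p := PMF.uniformOfFinset T hT with hp
  have hmeas : ∀ g : β → ℝ, Measurable g := fun g => measurable_from_top
  have hint : ∀ g : β → ℝ, ∫ x, g x ∂p.toMeasure = 𝔼 x ∈ T, g x := by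
    intro g
    have hfin : p.support.Finite := by
      rw [hp, PMF.support_uniformOfFinset]; exact T.finite_toSet
    have hgi : MeasureTheory.Integrable g p.toMeasure := by
      rw [← PMF.restrict_toMeasure_support p]
      exact MeasureTheory.IntegrableOn.of_finite hfin
    rw [PMF.integral_eq_tsum p g hgi, tsum_eq_sum (s := T), Finset.expect_eq_sum_div_card,
      Finset.sum_div]
    · refine Finset.sum_congr rfl fun x hx => ?_
      rw [hp, PMF.uniformOfFinset_apply_of_mem hT hx]
      simp [div_eq_inv_mul]
    · intro x hx
      rw [hp, PMF.uniformOfFinset_apply_of_notMem hT hx]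
      simp
  obtain ⟨y, hy, hmin⟩ := T.exists_min_image D hT
  have hb : ∀ᵐ x ∂p.toMeasure, D x ∈ Set.Icc (D y) (D y + c) := by
    rw [MeasureTheory.ae_iff, PMF.toMeasure_apply_eq_zero_iff _ (MeasurableSpace.measurableSet_top),
      hp, PMF.support_uniformOfFinset, Set.disjoint_left]
    intro x hx hx'
    refine hx' ⟨hmin x hx, ?_⟩
    linarith [(abs_le.1 (hD x hx y hy)).2]
  have h := (ProbabilityTheory.hasSubgaussianMGF_of_mem_Icc (hmeas D).aemeasurable hb).mgf_le 1
  rw [ProbabilityTheory.mgf] at h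
  simp only [one_mul, hint] at h
  refine h.trans (Real.exp_le_exp.2 (le_of_eq ?_))
  simp only [NNReal.coe_pow, NNReal.coe_div, coe_nnnorm, Real.norm_eq_abs, add_sub_cancel_left,
    NNReal.coe_ofNat, div_pow, sq_abs]
  ring

variable [DecidableEq β]

/-- Double counting of sets with a marked element: a uniform `(k + 1)`-set is a uniform first draw
followed by a uniform `k`-set from the remainder. -/
theorem expect_powersetCard_succ (T : Finset β) (k : ℕ) (hk : k + 1 ≤ T.card)
    (g : Finset β → ℝ) :
    𝔼 Ω ∈ Finset.powersetCard (k + 1) T, g Ω =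
      𝔼 x ∈ T, 𝔼 Ω ∈ Finset.powersetCard k (T.erase x), g (insert x Ω) := by
  have hsum : ∑ x ∈ T, ∑ Ω ∈ Finset.powersetCard k (T.erase x), g (insert x Ω) =
      (k + 1) * ∑ Ω ∈ Finset.powersetCard (k + 1) T, g Ω := by
    have h1 : (k + 1) * ∑ Ω ∈ Finset.powersetCard (k + 1) T, g Ω =
        ∑ Ω ∈ Finset.powersetCard (k + 1) T, ∑ _x ∈ Ω, g Ω := by
      rw [Finset.mul_sum]
      refine Finset.sum_congr rfl fun Ω hΩ => ?_
      rw [Finset.sum_const, (Finset.mem_powersetCard.1 hΩ).2, nsmul_eq_mul]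
      push_cast
      rfl
    rw [h1, Finset.sum_sigma', Finset.sum_sigma']
    refine Finset.sum_bij' (fun p _ => ⟨insert p.1 p.2, p.1⟩) (fun p _ => ⟨p.2, p.1.erase p.2⟩)
      ?_ ?_ ?_ ?_ ?_
    · rintro ⟨x, Ω⟩ h
      simp only [Finset.mem_sigma, Finset.mem_powersetCard, Finset.subset_erase] at h ⊢
      refine ⟨⟨Finset.insert_subset h.1 h.2.1.1, ?_⟩, Finset.mem_insert_self _ _⟩
      rw [Finset.card_insert_of_notMem h.2.1.2, h.2.2]
    · rintro ⟨Ω, x⟩ h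
      simp only [Finset.mem_sigma, Finset.mem_powersetCard] at h ⊢
      refine ⟨h.1.1 h.2, Finset.erase_subset_erase _ h.1.1, ?_⟩
      rw [Finset.card_erase_of_mem h.2, h.1.2, Nat.add_sub_cancel]
    · rintro ⟨x, Ω⟩ h
      simp only [Finset.mem_sigma, Finset.mem_powersetCard, Finset.subset_erase] at h
      simp [Finset.erase_insert h.2.1.2]
    · rintro ⟨Ω, x⟩ h
      simp only [Finset.mem_sigma] at h
      simp [Finset.insert_erase h.2]
    · rintro ⟨x, Ω⟩ _
      rfl
  have hT : 0 < T.card := by omega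
  have e1 : 𝔼 x ∈ T, 𝔼 Ω ∈ Finset.powersetCard k (T.erase x), g (insert x Ω) =
      (∑ x ∈ T, ∑ Ω ∈ Finset.powersetCard k (T.erase x), g (insert x Ω)) /
        (T.card * (T.card - 1).choose k) := by
    rw [Finset.expect_eq_sum_div_card, mul_comm, ← div_div]
    congr 1
    rw [Finset.sum_div]
    refine Finset.sum_congr rfl fun x hx => ?_
    rw [Finset.expect_eq_sum_div_card, Finset.card_powersetCard, Finset.card_erase_of_mem hx]
  rw [e1, hsum, Finset.expect_eq_sum_div_card, Finset.card_powersetCard]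
  have h2 : T.card * (T.card - 1).choose k = T.card.choose (k + 1) * (k + 1) := by
    have := Nat.add_one_mul_choose_eq (T.card - 1) k
    rwa [Nat.sub_add_cancel hT] at this
  have h3 : (T.card : ℝ) * (T.card - 1).choose k = T.card.choose (k + 1) * (k + 1) := by
    exact_mod_cast h2
  have h4 : (0 : ℝ) < T.card.choose (k + 1) := by exact_mod_cast Nat.choose_pos hk
  rw [h3]
  field_simp

/-- Condition on the first draw `x`. The conditional means `D x` vary by at most `c`, so Hoeffding's
lemma costs `c ^ 2 / 8`; the remaining `k` draws are handled by induction. -/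
theorem expect_exp_sub_expect_powersetCard_le (T : Finset β) (k : ℕ) (hk : k ≤ T.card)
    (g : Finset β → ℝ) {c : ℝ}
    (hg : ∀ x ∈ T, ∀ y ∈ T, ∀ Ω ⊆ T, x ∉ Ω → y ∉ Ω → |g (insert x Ω) - g (insert y Ω)| ≤ c) :
    𝔼 Ω ∈ Finset.powersetCard k T, Real.exp (g Ω - 𝔼 Ω' ∈ Finset.powersetCard k T, g Ω') ≤
      Real.exp (k * (c ^ 2 / 8)) := by
  induction k generalizing T g with
  | zero => simp
  | succ k ih =>
    set D : β → ℝ := fun x => 𝔼 Ω ∈ Finset.powersetCard k (T.erase x), g (insert x Ω) with hDdef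
    have hT : T.Nonempty := Finset.card_pos.1 (by omega)
    have hc : 0 ≤ c := by
      obtain ⟨x, hx⟩ := hT
      simpa using hg x hx x hx ∅ (Finset.empty_subset _) (by simp) (by simp)
    have hne : ∀ x ∈ T, (Finset.powersetCard k (T.erase x)).Nonempty := fun x hx =>
      Finset.powersetCard_nonempty.2 (by rw [Finset.card_erase_of_mem hx]; omega)
    have hD : ∀ x ∈ T, ∀ y ∈ T, |D x - D y| ≤ c := by
      intro x hx y hy
      -- Couples the draws following `x` and `y` by the transposition of `x` and `y`: the completed
      -- sets coincide if `y ∈ Ω`, and otherwise differ only in that one element.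
      have hDy : D y = 𝔼 Ω ∈ Finset.powersetCard k (T.erase x),
          g (insert y (Ω.map (Equiv.swap x y).toEmbedding)) := by
        refine (Finset.expect_equiv (Equiv.swap x y).finsetCongr (fun Ω => ?_)
          fun Ω _ => rfl).symm
        have hm : (T.erase x).map (Equiv.swap x y).toEmbedding = T.erase y := by
          ext z
          rw [Finset.mem_map_equiv, Equiv.symm_swap]
          simp only [Finset.mem_erase, Equiv.swap_apply_def]
          split_ifs <;> grind
        rw [Equiv.finsetCongr_apply, Finset.mem_powersetCard, Finset.mem_powersetCard,
          Finset.card_map, ← hm, Finset.map_subset_map]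
      rw [hDy, hDdef, ← Finset.expect_sub_distrib]
      have hpt : ∀ Ω ∈ Finset.powersetCard k (T.erase x),
          |g (insert x Ω) - g (insert y (Ω.map (Equiv.swap x y).toEmbedding))| ≤ c := by
        intro Ω hΩ
        rw [Finset.mem_powersetCard, Finset.subset_erase] at hΩ
        by_cases hyΩ : y ∈ Ω
        · have : insert y (Ω.map (Equiv.swap x y).toEmbedding) = insert x Ω := by
            ext z
            rw [Finset.mem_insert, Finset.mem_map_equiv, Equiv.symm_swap, Equiv.swap_apply_def,
              Finset.mem_insert]
            split_ifs <;> grind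
          rw [this]
          simpa using hc
        · have : Ω.map (Equiv.swap x y).toEmbedding = Ω := by
            ext z
            rw [Finset.mem_map_equiv, Equiv.symm_swap, Equiv.swap_apply_def]
            split_ifs <;> grind
          rw [this]
          exact hg x hx y hy Ω hΩ.1.1 hΩ.1.2 hyΩ
      rw [abs_le]
      constructor
      · exact Finset.le_expect (hne x hx) fun Ω hΩ => (abs_le.1 (hpt Ω hΩ)).1
      · exact Finset.expect_le (hne x hx) fun Ω hΩ => (abs_le.1 (hpt Ω hΩ)).2
    set μ := 𝔼 y ∈ T, D y with hμ
    rw [expect_powersetCard_succ T k hk g, expect_powersetCard_succ T k hk]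
    calc _ = 𝔼 x ∈ T, Real.exp (D x - μ) *
          𝔼 Ω ∈ Finset.powersetCard k (T.erase x), Real.exp (g (insert x Ω) - D x) := by
          refine Finset.expect_congr rfl fun x _ => ?_
          rw [Finset.mul_expect]
          refine Finset.expect_congr rfl fun Ω _ => ?_
          rw [← Real.exp_add]
          congr 1
          ring
      _ ≤ 𝔼 x ∈ T, Real.exp (D x - μ) * Real.exp (k * (c ^ 2 / 8)) := by
          refine Finset.expect_le_expect fun x hx => ?_
          refine mul_le_mul_of_nonneg_left ?_ (Real.exp_pos _).le
          refine ih (T.erase x) (by rw [Finset.card_erase_of_mem hx]; omega)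
            (fun Ω => g (insert x Ω)) ?_
          intro y hy z hz Ω hΩ hyΩ hzΩ
          rw [Finset.subset_erase] at hΩ
          rw [Finset.mem_erase] at hy hz
          rw [Finset.insert_comm x y, Finset.insert_comm x z]
          refine hg y hy.2 z hz.2 _ (Finset.insert_subset hx hΩ.1) ?_ ?_
          · simp [hy.1, hyΩ]
          · simp [hz.1, hzΩ]
      _ ≤ Real.exp (c ^ 2 / 8) * Real.exp (k * (c ^ 2 / 8)) := by
          rw [← Finset.expect_mul]
          exact mul_le_mul_of_nonneg_right (expect_exp_sub_expect_le T hT D hD) (Real.exp_pos _).le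
      _ = _ := by
          rw [← Real.exp_add]
          push_cast
          ring_nf

theorem card_filter_powersetCard_le (T : Finset β) (k K : ℕ) (hk : k ≤ T.card) (hkK : k ≤ K)
    (g : Finset β → ℝ) {c L : ℝ} (hc : 0 < c) (hK : 0 < K) (hL : 0 ≤ L)
    (hg : ∀ x ∈ T, ∀ y ∈ T, ∀ Ω ⊆ T, x ∉ Ω → y ∉ Ω → |g (insert x Ω) - g (insert y Ω)| ≤ c) :
    (((Finset.powersetCard k T).filter fun Ω =>
      𝔼 Ω' ∈ Finset.powersetCard k T, g Ω' + c * √K * √L < g Ω).card : ℝ) ≤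
      Real.exp (-L) * (Finset.powersetCard k T).card := by
  set Q := Finset.powersetCard k T with hQ
  set μ := 𝔼 Ω' ∈ Q, g Ω' with hμ
  have hKr : (0 : ℝ) < K := by exact_mod_cast hK
  -- Chernoff parameter: `l` times the threshold excess is `2 L`, while the log-moment is at most `L
  -- / 2 ≤ L` since `k ≤ K`; the difference leaves `exp (-L)`.
  set l : ℝ := 2 * √L / (c * √K) with hl
  have hs : 0 < √(K : ℝ) := Real.sqrt_pos.2 hKr
  have hl0 : 0 ≤ l := by positivity
  have hmgf := expect_exp_sub_expect_powersetCard_le T k hk (fun Ω => l * g Ω) (c := l * c) (by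
    intro x hx y hy Ω hΩ hxΩ hyΩ
    rw [← mul_sub, abs_mul, abs_of_nonneg hl0]
    exact mul_le_mul_of_nonneg_left (hg x hx y hy Ω hΩ hxΩ hyΩ) hl0)
  rw [← Finset.mul_expect, ← hQ, ← hμ] at hmgf
  have h1 : ((Q.filter fun Ω => μ + c * √K * √L < g Ω).card : ℝ) * Real.exp (2 * L) ≤
      Q.card * 𝔼 Ω ∈ Q, Real.exp (l * g Ω - l * μ) := by
    rw [Finset.card_mul_expect, ← nsmul_eq_mul, ← Finset.sum_const]
    refine (Finset.sum_le_sum fun Ω hΩ => ?_).trans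
      (Finset.sum_le_sum_of_subset_of_nonneg (Finset.filter_subset _ _)
        fun _ _ _ => (Real.exp_pos _).le)
    refine Real.exp_le_exp.2 ?_
    have h := (Finset.mem_filter.1 hΩ).2
    have e : 2 * L = l * (c * √K * √L) := by
      rw [hl]
      field_simp
      rw [Real.sq_sqrt hL]
    rw [e, ← mul_sub]
    exact mul_le_mul_of_nonneg_left (by linarith) hl0
  have h2 : 𝔼 Ω ∈ Q, Real.exp (l * g Ω - l * μ) ≤ Real.exp L := by
    refine hmgf.trans (Real.exp_le_exp.2 ?_)
    have e : (l * c) ^ 2 = 4 * L / K := by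
      rw [hl, div_mul_eq_mul_div, div_pow, mul_pow, mul_pow, mul_pow, Real.sq_sqrt hL,
        Real.sq_sqrt hKr.le]
      field_simp
      ring
    have hkr : (k : ℝ) ≤ K := by exact_mod_cast hkK
    rw [e]
    calc (k : ℝ) * (4 * L / K / 8) ≤ K * (4 * L / K / 8) := by gcongr
      _ = L / 2 := by field_simp; ring
      _ ≤ L := by linarith
  have h3 := h1.trans (mul_le_mul_of_nonneg_left h2 (Nat.cast_nonneg _))
  have e2 : Real.exp (2 * L) = Real.exp L * Real.exp L := by rw [← Real.exp_add]; ring_nf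
  rw [e2, ← mul_assoc] at h3
  have h4 := le_of_mul_le_mul_right h3 (Real.exp_pos _)
  rw [Real.exp_neg, inv_mul_eq_div, le_div_iff₀ (Real.exp_pos _)]
  exact h4

end BoundedDifferences

/-! ### From deviations of sums to the risk bound. -/

section Risk

variable {n m : ℕ}

theorem expect_powersetCard_sum {ι : Type*} [Fintype ι] [DecidableEq ι] {k : ℕ}
    (hk : k ≤ Fintype.card ι) (f : ι → ℝ) :
    𝔼 Ω ∈ Finset.powersetCard k Finset.univ, ∑ i ∈ Ω, f i = k * 𝔼 i, f i := by
  obtain ⟨A, rfl⟩ : ∃ A : Finset ι, A.card = k := by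
    obtain ⟨A, -, hA⟩ := Finset.exists_subset_card_eq hk
    exact ⟨A, hA⟩
  have hpt : ∀ i : ι, 𝔼 π : Equiv.Perm ι, f (π i) = 𝔼 j, f j := by
    intro i
    have : Nonempty ι := ⟨i⟩
    have h1 : ∀ j, 𝔼 π : Equiv.Perm ι, f (π i) = 𝔼 π : Equiv.Perm ι, f (π j) := fun j =>
      Fintype.expect_equiv (Equiv.mulRight (Equiv.swap i j)) _ _ fun π => by simp
    calc _ = 𝔼 _j : ι, 𝔼 π : Equiv.Perm ι, f (π i) := (Fintype.expect_const _).symm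
      _ = 𝔼 j : ι, 𝔼 π : Equiv.Perm ι, f (π j) := Finset.expect_congr rfl fun j _ => h1 j
      _ = 𝔼 π : Equiv.Perm ι, 𝔼 j : ι, f (π j) := Finset.expect_comm _ _ _
      _ = 𝔼 _π : Equiv.Perm ι, 𝔼 j : ι, f j :=
          Finset.expect_congr rfl fun π _ => Fintype.expect_equiv π _ _ fun _ => rfl
      _ = _ := Fintype.expect_const _
  rw [expect_powersetCard_eq_expect_perm]
  simp only [Finset.sum_map, Equiv.coe_toEmbedding]
  rw [Finset.expect_sum_comm, Finset.sum_congr rfl fun i _ => hpt i, Finset.sum_const,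
    nsmul_eq_mul]

theorem empRisk_obsMatrix (loss : ℝ → ℝ → ℝ) (Ω : Finset (Fin n × Fin m))
    (X : Matrix (Fin n) (Fin m) ℝ) :
    empRisk loss (obsMatrix Ω) X = 1 / ((m : ℝ) * n) *
      (∑ p : Fin n × Fin m, loss (X p.1 p.2) 0 +
        ∑ p ∈ Ω, (loss (X p.1 p.2) 1 - loss (X p.1 p.2) 0)) := by
  unfold empRisk
  rw [← Fintype.sum_prod_type' (f := fun i j => loss (X i j) (obsMatrix Ω i j)),
    ← Finset.sum_filter_add_sum_filter_not Finset.univ (· ∈ Ω),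
    ← Finset.sum_filter_add_sum_filter_not Finset.univ (· ∈ Ω)
      (fun p : Fin n × Fin m => loss (X p.1 p.2) 0), Finset.sum_sub_distrib]
  have h1 : ∑ p with p ∈ Ω, loss (X p.1 p.2) (obsMatrix Ω p.1 p.2) =
      ∑ p ∈ Ω, loss (X p.1 p.2) 1 := by
    refine Finset.sum_congr (by ext; simp) fun p hp => ?_
    simp [obsMatrix, hp]
  have h2 : ∑ p with p ∉ Ω, loss (X p.1 p.2) (obsMatrix Ω p.1 p.2) =
      ∑ p with p ∉ Ω, loss (X p.1 p.2) 0 := by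
    refine Finset.sum_congr rfl fun p hp => ?_
    simp [obsMatrix, (Finset.mem_filter.1 hp).2]
  have h3 : ∑ p with p ∈ Ω, loss (X p.1 p.2) 0 = ∑ p ∈ Ω, loss (X p.1 p.2) 0 :=
    Finset.sum_congr (by ext; simp) fun _ _ => rfl
  rw [h1, h2, h3]
  ring

theorem expRisk_eq_expect (loss : ℝ → ℝ → ℝ) (Y X : Matrix (Fin n) (Fin m) ℝ) (k : ℕ)
    (hk : k ≤ (ones Y).card) :
    expRisk loss Y k hk X =
      𝔼 Ω ∈ Finset.powersetCard k (ones Y), empRisk loss (obsMatrix Ω) X := by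
  unfold expRisk obsLaw
  rw [Finset.expect_eq_sum_div_card, Finset.sum_div]
  symm
  refine Finset.sum_subset_zero_on_sdiff (Finset.subset_univ _) (fun Ω hΩ => ?_) fun Ω hΩ => ?_
  · rw [PMF.uniformOfFinset_apply_of_notMem _ (Finset.mem_sdiff.1 hΩ).2]
    simp
  · rw [PMF.uniformOfFinset_apply_of_mem _ hΩ]
    simp [div_eq_inv_mul]

theorem expect_powersetCard_subtype {β : Type*} [DecidableEq β] (T : Finset β) (k : ℕ) (g : Finset β → ℝ) :
    𝔼 Ω ∈ Finset.powersetCard k T, g Ω =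
      𝔼 Ω ∈ Finset.powersetCard k (Finset.univ : Finset {p // p ∈ T}),
        g (Ω.map (Function.Embedding.subtype _)) := by
  symm
  refine Finset.expect_nbij (fun Ω => Ω.map (Function.Embedding.subtype _)) ?_ (fun _ _ => rfl) ?_ ?_
  · intro Ω hΩ
    rw [Finset.mem_powersetCard] at hΩ ⊢
    refine ⟨fun p hp => ?_, by rw [Finset.card_map, hΩ.2]⟩
    obtain ⟨q, -, rfl⟩ := Finset.mem_map.1 hp
    exact q.2
  · exact (Finset.map_injective _).injOn
  · intro Ω hΩ
    rw [Finset.mem_coe, Finset.mem_powersetCard] at hΩ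
    refine ⟨Finset.univ.filter fun p => p.1 ∈ Ω, ?_, ?_⟩
    all_goals
      have e : (Finset.univ.filter fun p : {p // p ∈ T} => p.1 ∈ Ω).map
          (Function.Embedding.subtype _) = Ω := by
        ext p
        simp only [Finset.mem_map, Finset.mem_filter, Finset.mem_univ, true_and,
          Function.Embedding.subtype_apply, Subtype.exists, exists_and_left, exists_prop,
          exists_eq_right_right]
        exact ⟨fun h => h.1, fun h => ⟨h, hΩ.1 h⟩⟩
    · rw [Finset.mem_coe, Finset.mem_powersetCard]
      exact ⟨Finset.subset_univ _, by rw [← hΩ.2, ← e, Finset.card_map, e]⟩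
    · exact e

/-- The loss at position `p` when nothing is observed there, minus the loss when a one is
observed. -/
noncomputable def lossGap (loss : ℝ → ℝ → ℝ) (ε : ℝ) (T : Finset (Fin n × Fin m))
    (p : {p // p ∈ T}) (X : feasible n m ε) : ℝ :=
  loss (X.1 p.1.1 p.1.2) 0 - loss (X.1 p.1.1 p.1.2) 1

theorem expRisk_sub_empRisk (loss : ℝ → ℝ → ℝ) (Y : Matrix (Fin n) (Fin m) ℝ) (k : ℕ)
    (hk : k ≤ (ones Y).card) {ε : ℝ} (X : feasible n m ε) {Ω : Finset {p // p ∈ ones Y}}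
    (hΩ : Ω.card = k) :
    expRisk loss Y k hk X.1 -
        empRisk loss (obsMatrix (Ω.map (Function.Embedding.subtype _))) X.1 =
      1 / ((m : ℝ) * n) * (∑ p ∈ Ω, lossGap loss ε (ones Y) p X -
        Ω.card * 𝔼 p, lossGap loss ε (ones Y) p X) := by
  have hne : (Finset.powersetCard k (Finset.univ : Finset {p // p ∈ ones Y})).Nonempty :=
    Finset.powersetCard_nonempty.2 (by simpa using hk)
  rw [expRisk_eq_expect, expect_powersetCard_subtype]
  simp only [empRisk_obsMatrix, Finset.sum_map]
  rw [← Finset.mul_expect, ← mul_sub, Finset.expect_add_distrib, Finset.expect_const hne]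
  have h := expect_powersetCard_sum (k := k) (by simpa using hk)
    fun p : {p // p ∈ ones Y} => loss (X.1 p.1.1 p.1.2) 1 - loss (X.1 p.1.1 p.1.2) 0
  have h2 : ∀ p, lossGap loss ε (ones Y) p X =
      -(loss (X.1 p.1.1 p.1.2) 1 - loss (X.1 p.1.1 p.1.2) 0) := fun p => (neg_sub _ _).symm
  simp only [Function.Embedding.subtype_apply, h2, Finset.sum_neg_distrib,
    Finset.expect_neg_distrib]
  rw [h, hΩ]
  ring

/-- At each fixed `x` the centering terms agree, because both sets have the same size, so only `f i
x - f j x` remains. -/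
theorem abs_maxDeviation_insert_sub_le {𝒳 ι : Type*} [Fintype ι] [DecidableEq ι] [Nonempty 𝒳]
    {f : ι → 𝒳 → ℝ} (hf : ∀ i, IsBdd (f i)) {c : ℝ} (hc : ∀ i j x, f i x - f j x ≤ c)
    {i j : ι} {Ω : Finset ι} (hi : i ∉ Ω) (hj : j ∉ Ω) :
    |maxDeviation f (insert i Ω) - maxDeviation f (insert j Ω)| ≤ c := by
  have key : ∀ i j, i ∉ Ω → j ∉ Ω →
      maxDeviation f (insert i Ω) ≤ c + maxDeviation f (insert j Ω) := by
    intro i j hi hj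
    refine ciSup_le fun x => ?_
    have h : _ ≤ maxDeviation f (insert j Ω) :=
      le_ciSup (isBdd_deviation hf (insert j Ω)).bddAbove x
    rw [Finset.card_insert_of_notMem hj, Finset.sum_insert hj] at h
    rw [Finset.card_insert_of_notMem hi, Finset.sum_insert hi]
    linarith [hc i j x]
  rw [abs_le]
  constructor <;> linarith [key i j hi hj, key j i hj hi]

theorem lossGap_bounds {loss : ℝ → ℝ → ℝ} {α ε : ℝ} {T : Finset (Fin n × Fin m)}
    (hloss : ∀ x ∈ Set.Icc (0 : ℝ) 1, ∀ y ∈ Set.Icc (0 : ℝ) 1,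
      |(loss x 0 - loss x 1) - (loss y 0 - loss y 1)| ≤ α * |x - y|) (hα : 0 ≤ α) :
    (∀ p, IsBdd (lossGap loss ε T p)) ∧
      ∀ p q X, lossGap loss ε T p X - lossGap loss ε T q X ≤ α := by
  have hle : ∀ x ∈ Set.Icc (0 : ℝ) 1, ∀ y ∈ Set.Icc (0 : ℝ) 1,
      |(loss x 0 - loss x 1) - (loss y 0 - loss y 1)| ≤ α := fun x hx y hy =>
    (hloss x hx y hy).trans (mul_le_of_le_one_right hα
      (abs_le.2 ⟨by linarith [hx.1, hy.2], by linarith [hx.2, hy.1]⟩))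
  refine ⟨fun p => ⟨α + |loss 0 0 - loss 0 1|, fun X => ?_⟩, fun p q X => ?_⟩
  · have h1 := hle _ (X.2.2 p.1.1 p.1.2) 0 (by simp)
    have h2 := abs_add_le ((loss (X.1 p.1.1 p.1.2) 0 - loss (X.1 p.1.1 p.1.2) 1) -
      (loss 0 0 - loss 0 1)) (loss 0 0 - loss 0 1)
    rw [sub_add_cancel] at h2
    exact h2.trans (by linarith)
  · exact (le_abs_self _).trans (hle _ (X.2.2 p.1.1 p.1.2) _ (X.2.2 q.1.1 q.1.2))

/-- The constant is `2 * 38`: `2` from symmetrization, `38` from the norm of the sign matrix. -/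
theorem meanDeviation_lossGap_le (hn : 0 < n) (hm : 0 < m) {loss : ℝ → ℝ → ℝ} {α ε : ℝ}
    {T : Finset (Fin n × Fin m)} [Nonempty (feasible n m ε)]
    (hloss : ∀ x ∈ Set.Icc (0 : ℝ) 1, ∀ y ∈ Set.Icc (0 : ℝ) 1,
      |(loss x 0 - loss x 1) - (loss y 0 - loss y 1)| ≤ α * |x - y|)
    (hα : 0 ≤ α) (hε : 0 ≤ ε) {k : ℕ} (hk : k ≤ T.card) :
    meanDeviation (lossGap loss ε T) k ≤ 76 * (ε * α * (√n + √m)) := by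
  have hbd := (lossGap_bounds (ε := ε) (T := T) hloss hα).1
  have hX : ∀ p : {p // p ∈ T}, IsBdd fun X : feasible n m ε => α * X.1 p.1.1 p.1.2 := fun p =>
    IsBdd.const_mul ⟨1, fun X => abs_le.2
      ⟨by linarith [(X.2.2 p.1.1 p.1.2).1], (X.2.2 p.1.1 p.1.2).2⟩⟩ α
  have hR : ∀ (k : ℕ) (a : Fin k → {p // p ∈ T}), Function.Injective a →
      𝔼 s : Fin k → Bool, ⨆ X, ∑ l, sgn (s l) * lossGap loss ε T (a l) X ≤
        38 * (ε * α * (√n + √m)) := by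
    intro k a ha
    have h1 := expect_ciSup_le_of_contraction (k := k) (IsBdd.zero (𝒳 := feasible n m ε))
      (fun l => hbd (a l)) (fun l => hX (a l)) (fun l X X' => by
        rw [← mul_sub, abs_mul, abs_of_nonneg hα]
        exact hloss _ (X.2.2 _ _) _ (X'.2.2 _ _))
    simp only [zero_add] at h1
    obtain ⟨Q, hQ, hQ0, hQe⟩ := exists_rademacher_bound hn hm (fun l => (a l).1)
      (Subtype.val_injective.comp ha)
    calc _ ≤ _ := h1
      _ ≤ 𝔼 s : Fin k → Bool, Q s * (ε * α) := by
          refine Finset.expect_le_expect fun s _ => ciSup_le fun X => ?_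
          calc _ = α * ∑ l, sgn (s l) * X.1 (a l).1.1 (a l).1.2 := by
                rw [Finset.mul_sum]
                exact Finset.sum_congr rfl fun l _ => mul_left_comm _ _ _
            _ ≤ α * (Q s * ε) := by
                refine mul_le_mul_of_nonneg_left ((hQ s X.1).trans ?_) hα
                exact mul_le_mul_of_nonneg_left X.2.1 (hQ0 s)
            _ = _ := by ring
      _ ≤ 38 * (√n + √m) * (ε * α) := by
          rw [← Finset.expect_mul]
          exact mul_le_mul_of_nonneg_right hQe (by positivity)
      _ = _ := by ring
  have := meanDeviation_le hbd hR (k := k) (by simpa using hk)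
  linarith

theorem isLeast_empRisk {loss : ℝ → ℝ → ℝ} (hcont : ∀ a, Continuous fun x => loss x a)
    {ε : ℝ} (hne : (feasible n m ε).Nonempty) (A : Matrix (Fin n) (Fin m) ℝ) :
    ∃ r, IsLeast (empRisk loss A '' feasible n m ε) r := by
  refine ((isCompact_feasible ε).image ?_).exists_isLeast (hne.image _)
  unfold empRisk
  refine continuous_const.mul
    (continuous_finsetSum _ fun i _ => continuous_finsetSum _ fun j _ => ?_)
  exact (hcont (A i j)).comp (continuous_id.matrix_elem i j)

theorem le_toOuterMeasure_obsLaw (Y : Matrix (Fin n) (Fin m) ℝ) (k : ℕ) (hk : k ≤ (ones Y).card)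
    {δ : ℝ} (B : Finset (Finset {p // p ∈ ones Y}))
    (hB : (B.card : ℝ) ≤
      δ * (Finset.powersetCard k (Finset.univ : Finset {p // p ∈ ones Y})).card)
    (S : Set (Finset (Fin n × Fin m)))
    (hS : ∀ Ω ∈ Finset.powersetCard k (Finset.univ : Finset {p // p ∈ ones Y}), Ω ∉ B →
      Ω.map (Function.Embedding.subtype _) ∈ S) :
    ENNReal.ofReal (1 - δ) ≤ (obsLaw Y k hk).toOuterMeasure S := by
  classical
  set Q := Finset.powersetCard k (Finset.univ : Finset {p // p ∈ ones Y}) with hQ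
  have hcard : Q.card = (Finset.powersetCard k (ones Y)).card := by
    simp [hQ, Finset.card_powersetCard]
  have hpos : 0 < (Finset.powersetCard k (ones Y)).card :=
    (Finset.powersetCard_nonempty.2 hk).card_pos
  have hsub : (Q \ B).card ≤ ((Finset.powersetCard k (ones Y)).filter (· ∈ S)).card := by
    refine Finset.card_le_card_of_injOn (fun Ω => Ω.map (Function.Embedding.subtype _)) ?_
      (Finset.map_injective _).injOn
    intro Ω hΩ
    rw [Finset.mem_coe, Finset.mem_sdiff] at hΩ
    rw [Finset.mem_coe, Finset.mem_filter, Finset.mem_powersetCard]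
    refine ⟨⟨fun p hp => ?_, ?_⟩, hS Ω hΩ.1 hΩ.2⟩
    · obtain ⟨q, -, rfl⟩ := Finset.mem_map.1 hp
      exact q.2
    · rw [Finset.card_map]; exact (Finset.mem_powersetCard.1 hΩ.1).2
  have h1 : ((1 - δ) * (Finset.powersetCard k (ones Y)).card : ℝ) ≤
      ((Finset.powersetCard k (ones Y)).filter (· ∈ S)).card := by
    have h2 : Q.card ≤ (Q \ B).card + B.card := by
      have := Finset.le_card_sdiff B Q
      omega
    have h3 : (Q.card : ℝ) ≤ (Q \ B).card + B.card := by exact_mod_cast h2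
    have h4 : ((Q \ B).card : ℝ) ≤ ((Finset.powersetCard k (ones Y)).filter (· ∈ S)).card := by
      exact_mod_cast hsub
    rw [← hcard]
    linarith
  rw [obsLaw, PMF.toOuterMeasure_uniformOfFinset_apply, ENNReal.le_div_iff_mul_le
    (Or.inl (by exact_mod_cast hpos.ne')) (Or.inl (ENNReal.natCast_ne_top _)),
    ← ENNReal.ofReal_natCast, ← ENNReal.ofReal_mul' (Nat.cast_nonneg _), ← ENNReal.ofReal_natCast]
  exact ENNReal.ofReal_le_ofReal h1

theorem lossI_lipschitz {α : ℝ} (hα : 1 ≤ α) : ∀ x ∈ Set.Icc (0 : ℝ) 1, ∀ y ∈ Set.Icc (0 : ℝ) 1,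
    |(lossI α x 0 - lossI α x 1) - (lossI α y 0 - lossI α y 1)| ≤ α * |x - y| := by
  intro x hx y hy
  -- The factor in front of `x - y` interpolates between `α` and `1`, since `(x + y) / 2` lies in
  -- `[0,1]`.
  have e : (lossI α x 0 - lossI α x 1) - (lossI α y 0 - lossI α y 1) =
      (α - (α - 1) * ((x + y) / 2)) * (x - y) := by
    simp [lossI, sqLoss]
    ring
  rw [e, abs_mul]
  refine mul_le_mul_of_nonneg_right (abs_le.2 ?_) (abs_nonneg _)
  have h0 : 0 ≤ (x + y) / 2 := by linarith [hx.1, hy.1]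
  have h1 : (x + y) / 2 ≤ 1 := by linarith [hx.2, hy.2]
  constructor <;> nlinarith

theorem lossII_lipschitz {α : ℝ} (hα : 1 ≤ α) : ∀ x ∈ Set.Icc (0 : ℝ) 1,
    ∀ y ∈ Set.Icc (0 : ℝ) 1,
    |(lossII α x 0 - lossII α x 1) - (lossII α y 0 - lossII α y 1)| ≤ α * |x - y| := by
  intro x _ y _
  have e : (lossII α x 0 - lossII α x 1) - (lossII α y 0 - lossII α y 1) = α * (x - y) := by
    simp [lossII, sqLoss]
    ring
  rw [e, abs_mul, abs_of_nonneg (by linarith)]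

theorem continuous_lossI (α a : ℝ) : Continuous fun x => lossI α x a := by
  unfold lossI sqLoss
  fun_prop

theorem continuous_lossII (α a : ℝ) : Continuous fun x => lossII α x a := by
  unfold lossII sqLoss
  fun_prop

theorem risk_bound_of_lipschitz (hn : 0 < n) (hm : 0 < m) {ε α δ : ℝ} (hε : 0 < ε) (hα : 1 ≤ α)
    (hδ : 0 < δ) (hδ1 : δ < 1) (Y : Matrix (Fin n) (Fin m) ℝ) {loss : ℝ → ℝ → ℝ}
    (hcont : ∀ a, Continuous fun x => loss x a)
    (hloss : ∀ x ∈ Set.Icc (0 : ℝ) 1, ∀ y ∈ Set.Icc (0 : ℝ) 1,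
      |(loss x 0 - loss x 1) - (loss y 0 - loss y 1)| ≤ α * |x - y|)
    (hne : (feasible n m ε).Nonempty) (k : ℕ) (hk : k ≤ (ones Y).card) :
    ENNReal.ofReal (1 - δ) ≤ (obsLaw Y k hk).toOuterMeasure
      {Ω | ∃ r : ℝ, IsLeast (empRisk loss (obsMatrix Ω) '' feasible n m ε) r ∧
        (∀ X ∈ feasible n m ε, empRisk loss (obsMatrix Ω) X = r →
          expRisk loss Y k hk X - r ≤ lossBound 76 n m (ones Y).card ε α δ) ∧
        (∀ X ∈ feasible n m ε, expRisk loss Y k hk X - empRisk loss (obsMatrix Ω) X ≤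
          lossBound 76 n m (ones Y).card ε α δ)} := by
  have : Nonempty (feasible n m ε) := hne.to_subtype
  have hα0 : 0 < α := by linarith
  have hmn : (0 : ℝ) < (m : ℝ) * n := by positivity
  set L := Real.log (2 / δ) with hL
  have hL0 : 0 ≤ L := Real.log_nonneg (by rw [le_div_iff₀ hδ]; linarith)
  obtain ⟨hbd, hosc⟩ := lossGap_bounds (ε := ε) (T := ones Y) hloss hα0.le
  have hcard : (ones Y).card ≤ m * n := by
    have := Finset.card_le_univ (ones Y)
    simpa [mul_comm] using this
  have hmean := meanDeviation_lossGap_le hn hm hloss hα0.le hε.le hk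
  have htail := card_filter_powersetCard_le (Finset.univ : Finset {p // p ∈ ones Y}) k (m * n)
    (by simpa using hk) (hk.trans hcard) (maxDeviation (lossGap loss ε (ones Y))) hα0
    (Nat.mul_pos hm hn) hL0
    fun p _ q _ Ω _ hp hq => abs_maxDeviation_insert_sub_le hbd hosc hp hq
  -- In fact `exp (-L) = δ / 2`, since only one tail is needed.
  have hexp : Real.exp (-L) ≤ δ := by
    rw [hL, Real.exp_neg, Real.exp_log (by positivity), inv_div]
    linarith
  refine le_toOuterMeasure_obsLaw Y k hk _
    (htail.trans (mul_le_mul_of_nonneg_right hexp (Nat.cast_nonneg _))) _ fun Ω hΩ hΩB => ?_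
  have hΩk := (Finset.mem_powersetCard.1 hΩ).2
  have hdev : maxDeviation (lossGap loss ε (ones Y)) Ω ≤
      76 * (ε * α * (√n + √m)) + α * √((m : ℝ) * n) * √L := by
    rw [Finset.mem_filter, not_and, not_lt] at hΩB
    refine (hΩB hΩ).trans ?_
    push_cast
    exact add_le_add hmean le_rfl
  have hall : ∀ X ∈ feasible n m ε, expRisk loss Y k hk X -
      empRisk loss (obsMatrix (Ω.map (Function.Embedding.subtype _))) X ≤
        lossBound 76 n m (ones Y).card ε α δ := by
    intro X hX
    rw [expRisk_sub_empRisk loss Y k hk ⟨X, hX⟩ hΩk]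
    have h1 : _ ≤ maxDeviation (lossGap loss ε (ones Y)) Ω :=
      le_ciSup (isBdd_deviation hbd Ω).bddAbove ⟨X, hX⟩
    calc _ ≤ 1 / ((m : ℝ) * n) * (76 * (ε * α * (√n + √m)) + α * √((m : ℝ) * n) * √L) :=
          mul_le_mul_of_nonneg_left (h1.trans hdev) (by positivity)
      _ = 76 * (ε * α * (√n + √m) / ((m : ℝ) * n)) +
            α * √L * (√((m : ℝ) * n) / ((m : ℝ) * n)) := by ring
      _ = 76 * (ε * α * (√n + √m) / ((m : ℝ) * n)) + α * √L / √((m : ℝ) * n) := by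
          rw [Real.sqrt_div_self', mul_one_div]
      _ ≤ _ := by
          unfold lossBound
          -- The only place where the `S^(1/4)` term enters, as a nonnegative surplus.
          have hS : √(n : ℝ) + √(m : ℝ) ≤ √(n : ℝ) + √(m : ℝ) + ((ones Y).card : ℝ) ^ (1 / 4 : ℝ) :=
            le_add_of_nonneg_right (by positivity)
          gcongr
  obtain ⟨r, hr⟩ := isLeast_empRisk hcont hne
    (obsMatrix (Ω.map (Function.Embedding.subtype _)))
  exact ⟨r, hr, fun X hX hXr => hXr ▸ hall X hX, hall⟩

end Risk

end CSRR

theorem mainTheorem1 :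
    ∃ C : ℝ, 0 < C ∧
      ∀ (n m : ℕ) (ε α q δ : ℝ) (M : Matrix (Fin n) (Fin m) ℝ) (loss : ℝ → ℝ → ℝ)
        (k : ℕ) (hk : k ≤ (CSRR.ones (CSRR.binarize M q)).card),
        0 < n → 0 < m → 0 < ε → 1 ≤ α → 0 ≤ q → q ≤ 1 → 0 < δ → δ < 1 →
        M ∈ CSRR.feasible n m ε →
        (loss = CSRR.lossI α ∨ loss = CSRR.lossII α) →
        ENNReal.ofReal (1 - δ) ≤
          (CSRR.obsLaw (CSRR.binarize M q) k hk).toOuterMeasure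
            {Ω | ∃ r : ℝ,
              IsLeast (CSRR.empRisk loss (CSRR.obsMatrix Ω) '' CSRR.feasible n m ε) r ∧
              (∀ X ∈ CSRR.feasible n m ε,
                CSRR.empRisk loss (CSRR.obsMatrix Ω) X = r →
                CSRR.expRisk loss (CSRR.binarize M q) k hk X - r ≤
                  CSRR.lossBound C n m (CSRR.ones (CSRR.binarize M q)).card ε α δ) ∧
              (∀ X ∈ CSRR.feasible n m ε,
                CSRR.expRisk loss (CSRR.binarize M q) k hk X -
                    CSRR.empRisk loss (CSRR.obsMatrix Ω) X ≤
                  CSRR.lossBound C n m (CSRR.ones (CSRR.binarize M q)).card ε α δ)} := by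
  refine ⟨76, by norm_num, ?_⟩
  intro n m ε α q δ M loss k hk hn hm hε hα _ _ hδ hδ1 hM hloss
  rcases hloss with rfl | rfl
  · exact CSRR.risk_bound_of_lipschitz hn hm hε hα hδ hδ1 _ (CSRR.continuous_lossI α)
      (CSRR.lossI_lipschitz hα) ⟨M, hM⟩ k hk
  · exact CSRR.risk_bound_of_lipschitz hn hm hε hα hδ hδ1 _ (CSRR.continuous_lossII α)
      (CSRR.lossII_lipschitz hα) ⟨M, hM⟩ k hk
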